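/- Consider an urn with $K$ colors. All vectors are row vectors. For a $K\times K$ matrix $A$ put $\|A\|=\max_i\sum_j|A_{ij}|$; a matrix $A$ with nonnegative entries is called irreducible if for all $i,j$ there is an integer $N\ge 1$ with $(A^N)_{ij}>0$. On a probability space let $C_0$ be a random vector in $\mathbb{R}^K$, let $(R_n)_{n\ge1}$ be random $K\times K$ matrices with nonnegative entries, and let $(\chi_n)_{n\ge1}$ be random vectors with values in the standard basis $\{e_1,\dots,e_K\}$ of $\mathbb{R}^K$ ($\chi_n=e_i$ means that color $i$ is chosen in the $n$-th trial). Define $C_n=C_{n-1}+\chi_nR_n$ for $n\ge1$, $S_n=\sum_{i=1}^K C_{n,i}$, $N_n=\sum_{k=1}^n\chi_k$, let $\mathcal F_n$ be the $\sigma$-field generated by $C_0$ and $(R_m,\chi_m)_{1\le m\le n}$, and let $H_{n-1}=E(R_n\mid\mathcal F_{n-1})$ for $n\ge1$. Assume: 1. $C_0$ is almost surely nonzero with nonnegative entries, and has finite mean; $P(\chi_n=e_i\mid\mathcal F_{n-1})=C_{n-1,i}/S_{n-1}$ almost surely for all $n\ge1$ and all $i$; and $\chi_n$ and $R_n$ are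 conditionally independent given $\mathcal F_{n-1}$ for all $n\ge1$. 2. There is a (measurable) function $\phi:[0,\infty)\to[0,\infty)$ that is eventually positive and nondecreasing, such that $x\mapsto x/\phi(x)$ is eventually nondecreasing, $\sum_n \frac1{n\phi(n)}<\infty$ (the sum being over the $n\ge1$ with $\phi(n)>0$), and $\sup_{n\ge1}E\big(\|R_n\|\,\phi(\|R_n\|)\big)<\infty$. 3. There is a (possibly random) matrix $H$ with nonnegative entries, almost surely irreducible, such that $\frac1n\sum_{k=0}^{n-1}\|H_k-H\|\to0$ almost surely. Then, almost surely, $H$ has a dominant eigenvalue $\lambda_H$ (a real eigenvalue whose real part is strictly larger than that of every other complex eigenvalue) and a unique left eigenvector $\pi_H$ for $\lambda_H$ that has strictly positive coordinates and is normalized to be a probability vector; and $$\frac{C_n}{S_n}\to\pi_H,\qquad \frac{S_n}{n}\to\lambda_H,\qquad \frac{C_n}{n}\to\lambda_H\pi_H,\qquad \frac{N_n}{n}\to\pi_H,$$ where each of the four convergences holds both almost surely and in $L^1$. -/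

import Mathlib

open MeasureTheory ProbabilityTheory Filter Topology
open scoped NNReal ENNReal Matrix

/- The norm on matrices is `‖A‖ = max_i ∑_j |A i j|`, the operator norm of the sup norm. -/
attribute [local instance] Matrix.linftyOpNormedAddCommGroup

namespace Urn

noncomputable section

variable {Ω : Type*} {K : ℕ}

/-- The Borel σ-field on real matrices, that is, the product σ-field of the entries. -/
instance instMeasurableSpaceMatrix : MeasurableSpace (Matrix (Fin K) (Fin K) ℝ) :=
  inferInstanceAs (MeasurableSpace (Fin K → Fin K → ℝ))

/-- The composition vectors `C_n` of the urn: `C_0` is given and `C_n = C_{n-1} + χ_n R_n` for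
`n ≥ 1`, vectors being row vectors. The values `χ 0` and `R 0` are never used. -/
def composition (C₀ : Ω → Fin K → ℝ) (χ : ℕ → Ω → Fin K → ℝ)
    (R : ℕ → Ω → Matrix (Fin K) (Fin K) ℝ) : ℕ → Ω → Fin K → ℝ
  | 0 => C₀
  | n + 1 => fun ω => composition C₀ χ R n ω + χ (n + 1) ω ᵥ* R (n + 1) ω

/-- The total content `S_n = ∑_i C_{n,i}` of the urn. -/
def total (C₀ : Ω → Fin K → ℝ) (χ : ℕ → Ω → Fin K → ℝ)
    (R : ℕ → Ω → Matrix (Fin K) (Fin K) ℝ) (n : ℕ) (ω : Ω) : ℝ :=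
  ∑ i, composition C₀ χ R n ω i

/-- The count vectors `N_n = ∑_{k=1}^n χ_k`. -/
def count (χ : ℕ → Ω → Fin K → ℝ) (n : ℕ) (ω : Ω) : Fin K → ℝ :=
  ∑ k ∈ Finset.Icc 1 n, χ k ω

/-- The σ-field `F_n` generated by `C_0` and `(R_m, χ_m)`, `1 ≤ m ≤ n`. -/
@[reducible]
def history (C₀ : Ω → Fin K → ℝ) (χ : ℕ → Ω → Fin K → ℝ)
    (R : ℕ → Ω → Matrix (Fin K) (Fin K) ℝ) (n : ℕ) : MeasurableSpace Ω :=
  MeasurableSpace.comap C₀ inferInstance ⊔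
    ⨆ m ∈ Finset.Icc 1 n,
      (MeasurableSpace.comap (R m) inferInstance ⊔ MeasurableSpace.comap (χ m) inferInstance)

/-- The generating matrices `H_n = E[R_{n+1} | F_n]` (entrywise conditional expectation). -/
def generating [MeasurableSpace Ω] (μ : Measure Ω) (C₀ : Ω → Fin K → ℝ)
    (χ : ℕ → Ω → Fin K → ℝ) (R : ℕ → Ω → Matrix (Fin K) (Fin K) ℝ) (n : ℕ) (ω : Ω) :
    Matrix (Fin K) (Fin K) ℝ :=
  Matrix.of fun i j => (μ[fun ω' => R (n + 1) ω' i j | history C₀ χ R n]) ω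

/-- Conditional independence of `X` and `Y` given the σ-field `m`, on an arbitrary probability
space: `P(X ∈ s, Y ∈ t | m) = P(X ∈ s | m) P(Y ∈ t | m)` almost surely, for all measurable
`s`, `t`. -/
def CondIndepGiven {α β : Type*} [MeasurableSpace α] [MeasurableSpace β] [MeasurableSpace Ω]
    (μ : Measure Ω) (m : MeasurableSpace Ω) (X : Ω → α) (Y : Ω → β) : Prop :=
  ∀ (s : Set α) (t : Set β), MeasurableSet s → MeasurableSet t →
    μ⟦X ⁻¹' s ∩ Y ⁻¹' t | m⟧ =ᵐ[μ] fun ω => (μ⟦X ⁻¹' s | m⟧) ω * (μ⟦Y ⁻¹' t | m⟧) ω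

/-- The urn model with random replacement matrices and its basic assumptions. -/
structure IsUrnModel [MeasurableSpace Ω] (μ : Measure Ω) (C₀ : Ω → Fin K → ℝ)
    (χ : ℕ → Ω → Fin K → ℝ) (R : ℕ → Ω → Matrix (Fin K) (Fin K) ℝ) : Prop where
  measurable_init : Measurable C₀
  measurable_choice : ∀ n, 1 ≤ n → Measurable (χ n)
  measurable_replacement : ∀ n, 1 ≤ n → Measurable (R n)
  /-- The replacement matrices have nonnegative entries. -/
  replacement_nonneg : ∀ n, 1 ≤ n → ∀ᵐ ω ∂μ, ∀ i j, 0 ≤ R n ω i j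
  /-- `χ_n` is the coordinate vector of the color chosen in the `n`-th trial. -/
  choice_basis : ∀ n, 1 ≤ n → ∀ᵐ ω ∂μ, ∃ i, χ n ω = Pi.single i 1
  /-- The initial configuration is nonzero with nonnegative entries and finite mean. -/
  init_nonneg : ∀ᵐ ω ∂μ, ∀ i, 0 ≤ C₀ ω i
  init_ne_zero : ∀ᵐ ω ∂μ, C₀ ω ≠ 0
  init_integrable : ∀ i, Integrable (fun ω => C₀ ω i) μ
  /-- `P(χ_n = e_i | F_{n-1}) = C_{n-1,i} / S_{n-1}`. -/
  choice_prob : ∀ n i,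
    μ⟦χ (n + 1) ⁻¹' {Pi.single i 1} | history C₀ χ R n⟧ =ᵐ[μ]
      fun ω => composition C₀ χ R n ω i / total C₀ χ R n ω
  /-- `χ_n` and `R_n` are conditionally independent given `F_{n-1}`. -/
  condIndep : ∀ n, CondIndepGiven μ (history C₀ χ R n) (χ (n + 1)) (R (n + 1))

/-- The admissible functions `φ : [0, ∞) → [0, ∞)`: eventually positive and nondecreasing, with
`x / φ x` eventually nondecreasing and `∑ 1 / (n φ(n)) < ∞`. The sum concerns the `n ≥ 1` with
`φ n > 0` (all but finitely many): the other terms are `0` in the formula below. -/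
structure IsAdmissible (φ : ℝ≥0 → ℝ≥0) : Prop where
  measurable : Measurable φ
  eventually_pos : ∀ᶠ x in atTop, 0 < φ x
  eventually_mono : ∃ x₀, MonotoneOn φ (Set.Ici x₀)
  eventually_mono_div : ∃ x₀, MonotoneOn (fun x => x / φ x) (Set.Ici x₀)
  summable : Summable fun n : ℕ => 1 / ((n : ℝ) * (φ n : ℝ))

/-- The bounded moment condition `sup_{n ≥ 1} E(‖R_n‖ φ(‖R_n‖)) < ∞`. -/
def BoundedMoment [MeasurableSpace Ω] (μ : Measure Ω) (φ : ℝ≥0 → ℝ≥0)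
    (R : ℕ → Ω → Matrix (Fin K) (Fin K) ℝ) : Prop :=
  ⨆ n : ℕ, ∫⁻ ω, ((‖R (n + 1) ω‖₊ * φ ‖R (n + 1) ω‖₊ : ℝ≥0) : ℝ≥0∞) ∂μ < ⊤

/-- `H` is an almost surely irreducible random matrix with nonnegative entries (nonnegativity is
part of `Matrix.IsIrreducible`), to which the generating matrices converge almost surely in the
Cesàro sense. -/
structure GeneratingCesaro [MeasurableSpace Ω] (μ : Measure Ω) (C₀ : Ω → Fin K → ℝ)
    (χ : ℕ → Ω → Fin K → ℝ) (R : ℕ → Ω → Matrix (Fin K) (Fin K) ℝ)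
    (H : Ω → Matrix (Fin K) (Fin K) ℝ) : Prop where
  measurable : Measurable H
  irreducible : ∀ᵐ ω ∂μ, (H ω).IsIrreducible
  cesaro : ∀ᵐ ω ∂μ, Tendsto
    (fun n : ℕ => (1 / (n : ℝ)) * ∑ k ∈ Finset.range n, ‖generating μ C₀ χ R k ω - H ω‖)
    atTop (𝓝 0)

/-- `lam` is the dominant eigenvalue of `A`: the complex eigenvalue with the largest real part. -/
def IsDominantEigenvalue (A : Matrix (Fin K) (Fin K) ℝ) (lam : ℝ) : Prop :=
  (lam : ℂ) ∈ spectrum ℂ (A.map Complex.ofReal) ∧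
    ∀ z ∈ spectrum ℂ (A.map Complex.ofReal), z ≠ (lam : ℂ) → z.re < lam

/-- `v` is a left eigenvector of `A` for `lam`, with strictly positive coordinates, normalized to
be a probability vector. -/
def IsPerronVector (A : Matrix (Fin K) (Fin K) ℝ) (lam : ℝ) (v : Fin K → ℝ) : Prop :=
  v ᵥ* A = lam • v ∧ (∀ i, 0 < v i) ∧ ∑ i, v i = 1

/-- Convergence both almost surely and in `L¹`. -/
def TendstoASAndL1 {E : Type*} [NormedAddCommGroup E] [MeasurableSpace Ω] (μ : Measure Ω)
    (f : ℕ → Ω → E) (g : Ω → E) : Prop :=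
  (∀ᵐ ω ∂μ, Tendsto (fun n => f n ω) atTop (𝓝 (g ω))) ∧
    (∀ n, Integrable (f n) μ) ∧ Integrable g μ ∧
    Tendsto (fun n => ∫⁻ ω, ‖f n ω - g ω‖ₑ ∂μ) atTop (𝓝 0)

end

end Urn

/-! Put `X_k = C_k / S_k` and `U_n = ∑_{k<n} X_k`. Conditional independence gives `E(χ_{k+1} R_{k+1}
| F_k) = X_k H_k` and `E(χ_{k+1} | F_k) = X_k`. A strong law for martingale differences, together
with the Cesàro hypothesis on `H_k`, then yields `C_n = U_n H + o(n)` and `N_n = U_n + o(n)` almost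
surely (`ae_tendsto_composition_sub`, `ae_tendsto_count_sub`). The strong law truncates at level `k
+ 1`; the summability of `1 / (n φ(n))` is what controls both the large and the truncated parts.

From here the argument is deterministic, for each sample path. Since `U_{n+1} = U_n + S_n⁻¹ C_n`,
the sequence `U_n` solves a perturbed linear recursion with matrix `H` and step sizes of order
`1/n`. Normalizing by `U_n · h`, where `h` is the right Perron eigenvector, turns it into a
stochastic-approximation scheme on the hyperplane `q · h = 0`. There the form `∑ (h_j / p_j) q_j²`,
with `p` the left eigenvector, is a Lyapunov function: the spectral gap `exists_gap` gives
contraction factors `1 - 2cθ_n`, and `∑ θ_n = ∞` forces convergence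
(`IsPerronPair.tendsto_average`). Thus `U_n / n → π_H`, and the four almost sure limits follow by
algebra.

For convergence in `L¹`, the proportions and `N_n / n` are bounded. The increments of `S_n` are
dominated by `‖R_n‖`, which are uniformly integrable because `φ` is unbounded, and averages inherit
this; `C_n / n` is the product of `S_n / n` and the bounded `X_n`. -/

namespace Urn

/-! ### Perron–Frobenius theory and the spectral gap. -/

section PerronFrobenius

variable {n : Type*} [Fintype n] {A : Matrix n n ℝ}

/-- Every entry is positive in some power of `A`, and a sum of powers commutes with `A`. Such an `M`
makes nonnegative nonzero vectors strictly positive without disturbing relations involving `A`. -/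
theorem exists_pos_commute [DecidableEq n] (hA : A.IsIrreducible) :
    ∃ M : Matrix n n ℝ, (∀ i j, 0 < M i j) ∧ M * A = A * M := by
  have h := (Matrix.isIrreducible_iff_exists_pow_pos hA.nonneg).1 hA
  choose k _ hk using h
  refine ⟨∑ i, ∑ j, A ^ k i j, fun a b => ?_, ?_⟩
  · simp only [Matrix.sum_apply]
    have h0 : ∀ i j, 0 ≤ (A ^ k i j) a b := fun i j => Matrix.pow_apply_nonneg hA.nonneg _ _ _
    calc 0 < (A ^ k a b) a b := hk a b
      _ ≤ ∑ j, (A ^ k a j) a b :=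
        Finset.single_le_sum (f := fun j => (A ^ k a j) a b) (fun j _ => h0 a j) (Finset.mem_univ b)
      _ ≤ _ := Finset.single_le_sum (f := fun i => ∑ j, (A ^ k i j) a b)
          (fun i _ => Finset.sum_nonneg fun j _ => h0 i j) (Finset.mem_univ a)
  · simp only [Finset.sum_mul, Finset.mul_sum, ← pow_succ, ← pow_succ']

theorem IsIrreducible.exists_pos_entry [DecidableEq n] (hA : A.IsIrreducible) (i : n) : ∃ j, 0 < A i j := by
  obtain ⟨k, hk, hpos⟩ := (Matrix.isIrreducible_iff_exists_pow_pos hA.nonneg).1 hA i i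
  by_contra! h
  have h0 : ∀ j, A i j = 0 := fun j => le_antisymm (h j) (hA.nonneg i j)
  obtain ⟨m, rfl⟩ := Nat.exists_eq_succ_of_ne_zero hk.ne'
  rw [Nat.succ_eq_add_one, pow_succ', Matrix.mul_apply] at hpos
  simp [h0] at hpos

theorem mulVec_pos {M : Matrix n n ℝ} (hM : ∀ i j, 0 < M i j) {x : n → ℝ} (hx : ∀ i, 0 ≤ x i)
    (hx0 : x ≠ 0) (i : n) : 0 < (M *ᵥ x) i := by
  obtain ⟨j, hj⟩ := Function.ne_iff.1 hx0
  have hj' : 0 < x j := lt_of_le_of_ne (hx j) (Ne.symm hj)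
  exact Finset.sum_pos' (fun j _ => mul_nonneg (hM i j).le (hx j))
    ⟨j, Finset.mem_univ j, mul_pos (hM i j) hj'⟩

theorem exists_eps_mul_le {x y : n → ℝ} (hx : ∀ i, 0 < x i) :
    ∃ ε > 0, ∀ i, ε * y i ≤ x i := by
  have : ∀ᶠ ε in 𝓝[>] (0 : ℝ), ∀ i, ε * y i ≤ x i := by
    refine eventually_all.2 fun i => ?_
    have hc : Tendsto (fun ε : ℝ => ε * y i) (𝓝[>] 0) (𝓝 (0 * y i)) :=
      ((continuous_id.mul continuous_const).tendsto 0).mono_left nhdsWithin_le_nhds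
    rw [zero_mul] at hc
    exact (hc.eventually (gt_mem_nhds (hx i))).mono fun _ h => h.le
  obtain ⟨ε, h1, h2⟩ := (this.and self_mem_nhdsWithin).exists
  exact ⟨ε, h2, h1⟩

/-- **Perron–Frobenius**: an irreducible matrix has a positive right eigenvector for a positive
eigenvalue. -/
theorem exists_pos_mulVec_eq_smul [DecidableEq n] [Nonempty n] (hA : A.IsIrreducible) :
    ∃ r : ℝ, 0 < r ∧ ∃ h : n → ℝ, (∀ i, 0 < h i) ∧ A *ᵥ h = r • h := by
  obtain ⟨M, hM, hMA⟩ := exists_pos_commute hA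
  -- The Collatz–Wielandt variational problem: maximize `r` subject to `r x ≤ A x` for `x` in the
  -- simplex. Summing the constraint bounds `r` by the sum of all entries, so the set is compact.
  let S : Set (ℝ × (n → ℝ)) :=
    {p | p ∈ Set.Icc 0 (∑ i, ∑ j, A i j) ×ˢ stdSimplex ℝ n ∧ ∀ i, p.1 * p.2 i ≤ (A *ᵥ p.2) i}
  have hSc : IsCompact S := by
    refine (isCompact_Icc.prod (isCompact_stdSimplex ℝ n)).inter_right
      (t := {p : ℝ × (n → ℝ) | ∀ i, p.1 * p.2 i ≤ (A *ᵥ p.2) i}) ?_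
    simp only [Set.ofPred_forall]
    refine isClosed_iInter fun i => isClosed_le (by fun_prop) ?_
    simp only [Matrix.mulVec, dotProduct]
    fun_prop
  have hmem : ∀ r x, 0 ≤ r → x ∈ stdSimplex ℝ n → (∀ i, r * x i ≤ (A *ᵥ x) i) → (r, x) ∈ S := by
    intro r x hr hx h
    refine ⟨⟨⟨hr, ?_⟩, hx⟩, h⟩
    calc r = ∑ i, r * x i := by rw [← Finset.mul_sum, hx.2, mul_one]
      _ ≤ ∑ i, (A *ᵥ x) i := Finset.sum_le_sum fun i _ => h i
      _ ≤ _ := Finset.sum_le_sum fun i _ => Finset.sum_le_sum fun j _ =>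
          mul_le_of_le_one_right (hA.nonneg i j) (by
            rw [← hx.2]; exact Finset.single_le_sum (fun k _ => hx.1 k) (Finset.mem_univ j))
  have hSne : S.Nonempty := by
    obtain ⟨i₀⟩ := ‹Nonempty n›
    refine ⟨(0, Pi.single i₀ 1), hmem _ _ le_rfl (single_mem_stdSimplex ℝ i₀) fun i => ?_⟩
    rw [zero_mul]
    exact Finset.sum_nonneg fun j _ => mul_nonneg (hA.nonneg i j)
      ((single_mem_stdSimplex ℝ i₀).1 j)
  obtain ⟨⟨r, x⟩, hrx, hmax⟩ := hSc.exists_isMaxOn hSne continuous_fst.continuousOn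
  have hx : x ∈ stdSimplex ℝ n := hrx.1.2
  have hr : 0 ≤ r := hrx.1.1.1
  have hx0 : x ≠ 0 := by
    rintro rfl
    simpa using hx.2
  have hy := mulVec_pos hM hx.1 hx0
  have hAy : A *ᵥ (M *ᵥ x) = M *ᵥ (A *ᵥ x) := by
    rw [Matrix.mulVec_mulVec, Matrix.mulVec_mulVec, hMA]
  have heig : A *ᵥ x = r • x := by
    -- `M` turns the nonzero nonnegative defect `A x - r x` into a strictly positive one, so the
    -- normalized `M x` is feasible for `r + ε`, against maximality.
    by_contra hne
    have hpos := mulVec_pos hM (x := A *ᵥ x - r • x)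
      (fun i => by simpa using hrx.2 i) (sub_ne_zero.2 hne)
    obtain ⟨ε, hε, hle⟩ := exists_eps_mul_le hpos (y := M *ᵥ x)
    set y := M *ᵥ x with hydef
    have hs : 0 < ∑ i, y i := Finset.sum_pos (fun i _ => hy i) Finset.univ_nonempty
    have hin : (r + ε, (∑ i, y i)⁻¹ • y) ∈ S := by
      refine hmem _ _ (by positivity) ⟨fun i => ?_, ?_⟩ fun i => ?_
      · exact mul_nonneg (inv_nonneg.2 hs.le) (hy i).le
      · simp only [Pi.smul_apply, smul_eq_mul, ← Finset.mul_sum]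
        exact inv_mul_cancel₀ hs.ne'
      · have := hle i
        rw [Matrix.mulVec_sub, Matrix.mulVec_smul, ← hAy, ← hydef] at this
        simp only [Pi.sub_apply, Pi.smul_apply, smul_eq_mul] at this
        rw [Matrix.mulVec_smul]
        simp only [Pi.smul_apply, smul_eq_mul]
        rw [mul_left_comm]
        refine mul_le_mul_of_nonneg_left ?_ (inv_nonneg.2 hs.le)
        linarith
    have := hmax hin
    simp only [Set.mem_ofPred_eq] at this
    linarith
  have hAM : A *ᵥ (M *ᵥ x) = r • (M *ᵥ x) := by rw [hAy, heig, Matrix.mulVec_smul]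
  refine ⟨r, ?_, M *ᵥ x, hy, hAM⟩
  obtain ⟨i⟩ := ‹Nonempty n›
  obtain ⟨j, hj⟩ := IsIrreducible.exists_pos_entry hA i
  have h1 : 0 < (A *ᵥ (M *ᵥ x)) i :=
    Finset.sum_pos' (fun j _ => mul_nonneg (hA.nonneg i j) (hy j).le)
      ⟨j, Finset.mem_univ j, mul_pos hj (hy j)⟩
  rw [hAM] at h1
  exact pos_of_mul_pos_left h1 (hy i).le

/-- Positive right and left eigenvectors for the same positive eigenvalue. -/
structure IsPerronPair (A : Matrix n n ℝ) (r : ℝ) (h p : n → ℝ) : Prop where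
  pos : 0 < r
  right_pos : ∀ i, 0 < h i
  left_pos : ∀ i, 0 < p i
  right_eq : A *ᵥ h = r • h
  left_eq : p ᵥ* A = r • p
  dot_eq : p ⬝ᵥ h = 1

/-- The left eigenvector is a right one of the transpose; evaluating `p A h` in two ways shows that
both eigenvalues agree, because `p · h > 0`. -/
theorem exists_isPerronPair [DecidableEq n] [Nonempty n] (hA : A.IsIrreducible) :
    ∃ r h p, IsPerronPair A r h p := by
  obtain ⟨r, hr, h, hh, hrh⟩ := exists_pos_mulVec_eq_smul hA
  obtain ⟨s, hs, p, hp, hsp⟩ := exists_pos_mulVec_eq_smul hA.transpose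
  rw [Matrix.mulVec_transpose] at hsp
  have hd : 0 < p ⬝ᵥ h := Finset.sum_pos (fun i _ => mul_pos (hp i) (hh i)) Finset.univ_nonempty
  have hrs : r = s := by
    have h1 := Matrix.dotProduct_mulVec p A h
    rw [hrh, hsp, dotProduct_smul, smul_dotProduct] at h1
    exact mul_right_cancel₀ hd.ne' h1
  subst hrs
  refine ⟨r, h, (p ⬝ᵥ h)⁻¹ • p, hr, hh, fun i => mul_pos (inv_pos.2 hd) (hp i), hrh, ?_, ?_⟩
  · rw [Matrix.smul_vecMul, hsp, smul_comm]
  · rw [smul_dotProduct, smul_eq_mul, inv_mul_cancel₀ hd.ne']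

variable {r : ℝ} {h p : n → ℝ}

/-- The weights `p_i A_ij h_j` have row sums `r p_i h_i` and column sums `r p_j h_j`. Expanding the
square therefore gives a Dirichlet form in the ratios `q_i / p_i`, even though `A` need not be
symmetric. -/
theorem IsPerronPair.quadratic_identity (hP : IsPerronPair A r h p) (q : n → ℝ) :
    ∑ j, h j / p j * ((q ᵥ* A) j * q j) = r * ∑ j, h j / p j * q j ^ 2
      - (∑ i, ∑ j, p i * A i j * h j * (q i / p i - q j / p j) ^ 2) / 2 := by
  have hp : ∀ i, p i ≠ 0 := fun i => (hP.left_pos i).ne'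
  have e1 : ∑ i, ∑ j, p i * A i j * h j * (q i / p i) ^ 2 = r * ∑ j, h j / p j * q j ^ 2 := by
    rw [Finset.mul_sum]
    refine Finset.sum_congr rfl fun i _ => ?_
    have h1 := congrFun hP.right_eq i
    simp only [Matrix.mulVec, dotProduct, Pi.smul_apply, smul_eq_mul] at h1
    calc _ = p i * (q i / p i) ^ 2 * ∑ j, A i j * h j := by
          rw [Finset.mul_sum]; exact Finset.sum_congr rfl fun j _ => by ring
      _ = _ := by rw [h1]; have := hp i; field_simp
  have e2 : ∑ i, ∑ j, p i * A i j * h j * (q j / p j) ^ 2 = r * ∑ j, h j / p j * q j ^ 2 := by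
    rw [Finset.sum_comm, Finset.mul_sum]
    refine Finset.sum_congr rfl fun j _ => ?_
    have h1 := congrFun hP.left_eq j
    simp only [Matrix.vecMul, dotProduct, Pi.smul_apply, smul_eq_mul] at h1
    calc _ = h j * (q j / p j) ^ 2 * ∑ i, p i * A i j := by
          rw [Finset.mul_sum]; exact Finset.sum_congr rfl fun i _ => by ring
      _ = _ := by rw [h1]; have := hp j; field_simp
  have e3 : ∑ i, ∑ j, p i * A i j * h j * (q i / p i * (q j / p j)) =
      ∑ j, h j / p j * ((q ᵥ* A) j * q j) := by
    rw [Finset.sum_comm]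
    refine Finset.sum_congr rfl fun j _ => ?_
    simp only [Matrix.vecMul, dotProduct, Finset.sum_mul, Finset.mul_sum]
    refine Finset.sum_congr rfl fun i _ => ?_
    have := hp i; have := hp j
    field_simp
  have e4 : ∑ i, ∑ j, p i * A i j * h j * (q i / p i - q j / p j) ^ 2 =
      ∑ i, ∑ j, p i * A i j * h j * (q i / p i) ^ 2
      + ∑ i, ∑ j, p i * A i j * h j * (q j / p j) ^ 2
      - 2 * ∑ i, ∑ j, p i * A i j * h j * (q i / p i * (q j / p j)) := by
    simp only [Finset.mul_sum, ← Finset.sum_add_distrib, ← Finset.sum_sub_distrib]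
    exact Finset.sum_congr rfl fun i _ => Finset.sum_congr rfl fun j _ => by ring
  rw [e4, e1, e2, e3]
  ring

/-- If the Dirichlet form vanishes, `q_i / p_i` is constant along the edges of the graph of `A`,
hence everywhere by connectedness. Then `q` is a multiple of `p`, and `q · h = 0` makes it zero. -/
theorem IsPerronPair.quadratic_lt (hA : A.IsIrreducible) (hP : IsPerronPair A r h p) {q : n → ℝ}
    (hq : q ⬝ᵥ h = 0) (hq0 : q ≠ 0) :
    ∑ j, h j / p j * ((q ᵥ* A) j * q j) < r * ∑ j, h j / p j * q j ^ 2 := by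
  have hterm : ∀ i j, 0 ≤ p i * A i j * h j * (q i / p i - q j / p j) ^ 2 := fun i j =>
    mul_nonneg (mul_nonneg (mul_nonneg (hP.left_pos i).le (hA.nonneg i j)) (hP.right_pos j).le)
      (sq_nonneg _)
  rw [hP.quadratic_identity q]
  suffices 0 < ∑ i, ∑ j, p i * A i j * h j * (q i / p i - q j / p j) ^ 2 by linarith
  refine lt_of_le_of_ne (Finset.sum_nonneg fun i _ => Finset.sum_nonneg fun j _ => hterm i j) ?_
  intro h0
  apply hq0
  have hedge : ∀ i j, 0 < A i j → q i / p i = q j / p j := by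
    intro i j hij
    have h1 := (Finset.sum_eq_zero_iff_of_nonneg
      (fun i _ => Finset.sum_nonneg fun j _ => hterm i j)).1 h0.symm i (Finset.mem_univ i)
    have h2 := (Finset.sum_eq_zero_iff_of_nonneg (fun j _ => hterm i j)).1 h1 j (Finset.mem_univ j)
    have h3 : 0 < p i * A i j * h j := mul_pos (mul_pos (hP.left_pos i) hij) (hP.right_pos j)
    exact sub_eq_zero.1 (pow_eq_zero_iff two_ne_zero |>.1 ((mul_eq_zero.1 h2).resolve_left h3.ne'))
  have hconst : ∀ i j, q i / p i = q j / p j := by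
    intro i j
    let := A.toQuiver
    obtain ⟨w, -⟩ := hA.connected i j
    induction w with
    | nil => rfl
    | cons _ e ih => exact ih.trans (hedge _ _ e.down)
  ext i
  have hqj : ∀ j, q j = q i / p i * p j := fun j => by
    rw [hconst i j, div_mul_cancel₀ _ (hP.left_pos j).ne']
  have : q ⬝ᵥ h = q i / p i := by
    rw [show q = (q i / p i) • p from funext hqj, smul_dotProduct, hP.dot_eq]
    simp [(hP.left_pos i).ne']
  rw [hq] at this
  rw [hqj i, ← this, zero_mul, Pi.zero_apply]

/-- The spectral gap of an irreducible matrix, in the form of a quadratic inequality on the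
invariant complement of the Perron eigenvector. -/
theorem IsPerronPair.exists_gap (hA : A.IsIrreducible) (hP : IsPerronPair A r h p) :
    ∃ c > 0, ∀ q : n → ℝ, q ⬝ᵥ h = 0 →
      ∑ j, h j / p j * ((q ᵥ* A) j * q j) ≤ (r - c) * ∑ j, h j / p j * q j ^ 2 := by
  set B : (n → ℝ) → ℝ := fun q => ∑ j, h j / p j * q j ^ 2
  set G : (n → ℝ) → ℝ := fun q => ∑ j, h j / p j * ((q ᵥ* A) j * q j)
  have hBc : Continuous B := by fun_prop
  have hGc : Continuous G := by
    simp only [G, Matrix.vecMul, dotProduct]; fun_prop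
  have hd : ∀ j, 0 < h j / p j := fun j => div_pos (hP.right_pos j) (hP.left_pos j)
  let S : Set (n → ℝ) := {q | q ⬝ᵥ h = 0} ∩ Metric.sphere 0 1
  have hS : IsCompact S := by
    refine (isCompact_sphere 0 1).inter_left (isClosed_eq ?_ continuous_const)
    simp only [dotProduct]; fun_prop
  have hBpos : ∀ q, q ≠ 0 → 0 < B q := by
    intro q hq
    obtain ⟨j, hj⟩ := Function.ne_iff.1 hq
    exact Finset.sum_pos' (fun j _ => mul_nonneg (hd j).le (sq_nonneg _))
      ⟨j, Finset.mem_univ j, mul_pos (hd j) (by have : q j ≠ 0 := hj; positivity)⟩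
  have hne : ∀ q ∈ S, q ≠ 0 := by
    rintro q hq rfl
    simpa using hq.2
  obtain ⟨c, hc, hcS⟩ : ∃ c > 0, ∀ q ∈ S, G q ≤ (r - c) * B q := by
    -- The hyperplane may be reduced to zero (a single color), in which case any gap will do.
    rcases S.eq_empty_or_nonempty with he | hne'
    · exact ⟨1, one_pos, by simp [he]⟩
    obtain ⟨q₀, hq₀, hmax⟩ := hS.exists_isMaxOn hne' (f := fun q => G q / B q)
      (hGc.continuousOn.div hBc.continuousOn fun q hq => (hBpos q (hne q hq)).ne')
    refine ⟨r - G q₀ / B q₀, ?_, fun q hq => ?_⟩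
    · rw [gt_iff_lt, sub_pos, div_lt_iff₀ (hBpos _ (hne _ hq₀))]
      exact hP.quadratic_lt hA hq₀.1 (hne _ hq₀)
    · rw [sub_sub_cancel, ← div_le_iff₀ (hBpos q (hne q hq))]
      exact hmax hq
  refine ⟨c, hc, fun q hq => ?_⟩
  rcases eq_or_ne q 0 with rfl | hq0
  · simp
  have hn : ‖q‖ ≠ 0 := norm_ne_zero_iff.2 hq0
  have := hcS (‖q‖⁻¹ • q) ⟨by simp [smul_dotProduct, hq], by simp [norm_smul, hn]⟩
  have e1 : G (‖q‖⁻¹ • q) = ‖q‖⁻¹ ^ 2 * G q := by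
    simp only [G, Matrix.smul_vecMul, Pi.smul_apply, smul_eq_mul, Finset.mul_sum]
    exact Finset.sum_congr rfl fun j _ => by ring
  have e2 : B (‖q‖⁻¹ • q) = ‖q‖⁻¹ ^ 2 * B q := by
    simp only [B, Pi.smul_apply, smul_eq_mul, Finset.mul_sum]
    exact Finset.sum_congr rfl fun j _ => by ring
  rw [e1, e2, mul_left_comm] at this
  exact le_of_mul_le_mul_left this (by positivity)

/-- Removing the component along `p` leaves an eigenvector for `r` in the complement, where the
strict quadratic inequality rules out anything but zero. -/
theorem IsPerronPair.eq_smul (hA : A.IsIrreducible) (hP : IsPerronPair A r h p) {v : n → ℝ}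
    (hv : v ᵥ* A = r • v) : v = (v ⬝ᵥ h) • p := by
  by_contra hne
  have hq : (v - (v ⬝ᵥ h) • p) ⬝ᵥ h = 0 := by
    simp [sub_dotProduct, smul_dotProduct, hP.dot_eq]
  have := hP.quadratic_lt hA hq (sub_ne_zero.2 hne)
  have e : (v - (v ⬝ᵥ h) • p) ᵥ* A = r • (v - (v ⬝ᵥ h) • p) := by
    rw [Matrix.sub_vecMul, Matrix.smul_vecMul, hv, hP.left_eq, smul_sub, smul_comm]
  rw [e, Finset.mul_sum] at this
  refine this.ne (Finset.sum_congr rfl fun j _ => ?_)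
  simp only [Pi.smul_apply, smul_eq_mul]
  ring

/-- Take a left eigenvector `a + ib`. In the sum of the quadratic forms of `a` and `b` the terms
with `Im z` cancel, leaving `Re z` times a positive number, so the gap gives `Re z ≤ r - c`. -/
theorem IsPerronPair.re_lt [DecidableEq n] (hA : A.IsIrreducible) (hP : IsPerronPair A r h p) {z : ℂ}
    (hz : z ∈ spectrum ℂ (A.map Complex.ofReal)) (hzr : z ≠ (r : ℂ)) : z.re < r := by
  obtain ⟨c, hc, hgap⟩ := hP.exists_gap hA
  rw [spectrum.mem_iff, Matrix.isUnit_iff_isUnit_det, isUnit_iff_ne_zero, not_not,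
    ← Matrix.exists_vecMul_eq_zero_iff] at hz
  obtain ⟨v, hv0, hv⟩ := hz
  have hvz : v ᵥ* A.map Complex.ofReal = z • v := by
    rw [Matrix.vecMul_sub, sub_eq_zero] at hv
    rw [← hv, Algebra.algebraMap_eq_smul_one, Matrix.vecMul_smul, Matrix.vecMul_one]
  set a : n → ℝ := fun i => (v i).re
  set b : n → ℝ := fun i => (v i).im
  have ha : ∀ j, (a ᵥ* A) j = z.re * a j - z.im * b j := fun j => by
    have := congrArg Complex.re (congrFun hvz j)
    simpa [Matrix.vecMul, dotProduct, a, b] using this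
  have hb : ∀ j, (b ᵥ* A) j = z.re * b j + z.im * a j := fun j => by
    have := congrArg Complex.im (congrFun hvz j)
    simpa [Matrix.vecMul, dotProduct, a, b] using this
  -- Pairing with `h` gives a homogeneous 2×2 system for `a · h` and `b · h`, whose determinant `(r
  -- - Re z)² + (Im z)²` is nonzero because `z ≠ r`.
  have hab : a ⬝ᵥ h = 0 ∧ b ⬝ᵥ h = 0 := by
    have h1 := Matrix.dotProduct_mulVec a A h
    have h2 := Matrix.dotProduct_mulVec b A h
    rw [hP.right_eq, dotProduct_smul, show a ᵥ* A = z.re • a - z.im • b from funext ha,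
      sub_dotProduct, smul_dotProduct, smul_dotProduct] at h1
    rw [hP.right_eq, dotProduct_smul, show b ᵥ* A = z.re • b + z.im • a from funext hb,
      add_dotProduct, smul_dotProduct, smul_dotProduct] at h2
    simp only [smul_eq_mul] at h1 h2
    have hne : 0 < (r - z.re) ^ 2 + z.im ^ 2 := by
      by_contra! hle
      have h3 : r - z.re = 0 := by nlinarith [sq_nonneg (r - z.re), sq_nonneg z.im]
      have h4 : z.im = 0 := by nlinarith [sq_nonneg (r - z.re), sq_nonneg z.im]
      exact hzr (Complex.ext (by simp; linarith) (by simp [h4]))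
    constructor
    · refine (mul_eq_zero.1 (?_ : ((r - z.re) ^ 2 + z.im ^ 2) * (a ⬝ᵥ h) = 0)).resolve_left hne.ne'
      linear_combination (r - z.re) * h1 - z.im * h2
    · refine (mul_eq_zero.1 (?_ : ((r - z.re) ^ 2 + z.im ^ 2) * (b ⬝ᵥ h) = 0)).resolve_left hne.ne'
      linear_combination (r - z.re) * h2 + z.im * h1
  have g1 := hgap a hab.1
  have g2 := hgap b hab.2
  have hd : ∀ j, 0 < h j / p j := fun j => div_pos (hP.right_pos j) (hP.left_pos j)
  have hsum : ∑ j, h j / p j * ((a ᵥ* A) j * a j) + ∑ j, h j / p j * ((b ᵥ* A) j * b j) =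
      z.re * (∑ j, h j / p j * a j ^ 2 + ∑ j, h j / p j * b j ^ 2) := by
    rw [← Finset.sum_add_distrib, ← Finset.sum_add_distrib, Finset.mul_sum]
    exact Finset.sum_congr rfl fun j _ => by rw [ha, hb]; ring
  have hpos : 0 < ∑ j, h j / p j * a j ^ 2 + ∑ j, h j / p j * b j ^ 2 := by
    obtain ⟨j, hj⟩ := Function.ne_iff.1 hv0
    rw [← Finset.sum_add_distrib]
    refine Finset.sum_pos' (fun j _ => ?_) ⟨j, Finset.mem_univ j, ?_⟩
    · have := hd j; positivity
    · rw [← mul_add]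
      refine mul_pos (hd j) ?_
      have : 0 < Complex.normSq (v j) := Complex.normSq_pos.2 hj
      rw [Complex.normSq_apply] at this
      simp only [a, b]; nlinarith
  have h5 : z.re ≤ r - c := by
    refine le_of_mul_le_mul_right ?_ hpos
    rw [← hsum, mul_add]
    exact add_le_add g1 g2
  linarith

theorem IsPerronPair.mem_spectrum [DecidableEq n] [Nonempty n] (hP : IsPerronPair A r h p) :
    (r : ℂ) ∈ spectrum ℂ (A.map Complex.ofReal) := by
  rw [spectrum.mem_iff, Matrix.isUnit_iff_isUnit_det, isUnit_iff_ne_zero, not_not,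
    ← Matrix.exists_vecMul_eq_zero_iff]
  refine ⟨fun i => (p i : ℂ), fun h0 => ?_, ?_⟩
  · obtain ⟨i⟩ := ‹Nonempty n›
    have := congrFun h0 i
    exact (hP.left_pos i).ne' (by simpa using this)
  · rw [Matrix.vecMul_sub, sub_eq_zero, Algebra.algebraMap_eq_smul_one, Matrix.vecMul_smul,
      Matrix.vecMul_one]
    ext j
    have := congrArg Complex.ofReal (congrFun hP.left_eq j)
    simpa [Matrix.vecMul, dotProduct] using this.symm

end PerronFrobenius

theorem IsPerronPair.isPerronVector {K : ℕ} [Nonempty (Fin K)] {A : Matrix (Fin K) (Fin K) ℝ} {r : ℝ}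
    {h p : Fin K → ℝ} (hP : IsPerronPair A r h p) :
    IsPerronVector A r ((∑ i, p i)⁻¹ • p) := by
  have hs : 0 < ∑ i, p i := Finset.sum_pos (fun i _ => hP.left_pos i) Finset.univ_nonempty
  refine ⟨?_, fun i => mul_pos (inv_pos.2 hs) (hP.left_pos i), ?_⟩
  · rw [Matrix.smul_vecMul, hP.left_eq, smul_comm]
  · simp only [Pi.smul_apply, smul_eq_mul, ← Finset.mul_sum]
    exact inv_mul_cancel₀ hs.ne'

/-- **Perron–Frobenius**: the dominant eigenvalue and the unique positive normalized left
eigenvector of an irreducible matrix. -/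
theorem exists_dominant_perron {K : ℕ} [Nonempty (Fin K)] {A : Matrix (Fin K) (Fin K) ℝ}
    (hA : A.IsIrreducible) : ∃ (lam : ℝ) (v : Fin K → ℝ), IsDominantEigenvalue A lam ∧
      IsPerronVector A lam v ∧ (∀ w, IsPerronVector A lam w → w = v) ∧
      ∃ h p, IsPerronPair A lam h p := by
  obtain ⟨r, h, p, hP⟩ := exists_isPerronPair hA
  refine ⟨r, (∑ i, p i)⁻¹ • p, ⟨hP.mem_spectrum, fun z hz => hP.re_lt hA hz⟩, hP.isPerronVector,
    fun w hw => ?_, h, p, hP⟩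
  have h1 := hP.eq_smul hA hw.1
  have h2 : (w ⬝ᵥ h) * ∑ i, p i = 1 := by
    rw [← hw.2.2, Finset.mul_sum]
    exact Finset.sum_congr rfl fun i _ => (congrFun h1 i).symm
  rw [← eq_inv_of_mul_eq_one_left h2]
  exact h1

/-! ### Contracting sequences of real numbers. -/

section Deterministic

/-- A nonnegative sequence contracted by factors `1 - t_n` with divergent `∑ t_n`, up to errors
which are small compared with `t_n`, converges to zero. -/
theorem tendsto_zero_of_contraction {V t κ : ℕ → ℝ} (hV : ∀ n, 0 ≤ V n)
    (ht : ∀ᶠ n in atTop, 0 ≤ t n ∧ t n ≤ 1)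
    (hsum : ∀ m, Tendsto (fun n => ∑ k ∈ Finset.Ico m n, t k) atTop atTop)
    (hκ : Tendsto κ atTop (𝓝 0))
    (hstep : ∀ᶠ n in atTop, V (n + 1) ≤ (1 - t n) * V n + t n * κ n) :
    Tendsto V atTop (𝓝 0) := by
  rw [Metric.tendsto_atTop']
  intro ε hε
  have hκ' : ∀ᶠ n in atTop, κ n < ε / 2 := hκ.eventually (gt_mem_nhds (by positivity))
  obtain ⟨m, hm⟩ := eventually_atTop.1 (ht.and (hstep.and hκ'))
  -- Once `κ < ε / 2`, the excess `V - ε / 2` is contracted by `1 - t ≤ exp (-t)` without any error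
  -- term.
  have key : ∀ n, m ≤ n → V n - ε / 2 ≤ V m * Real.exp (-∑ k ∈ Finset.Ico m n, t k) := by
    intro n hn
    induction n, hn using Nat.le_induction with
    | base => simp; positivity
    | succ n hn ih =>
      obtain ⟨⟨h0, h1⟩, h2, h3⟩ := hm n hn
      rw [Finset.sum_Ico_succ_top hn, neg_add, Real.exp_add, ← mul_assoc]
      have hexp : 1 - t n ≤ Real.exp (-t n) := by linarith [Real.add_one_le_exp (-t n)]
      calc V (n + 1) - ε / 2 ≤ (1 - t n) * (V n - ε / 2) := by nlinarith
        _ ≤ (1 - t n) * (V m * Real.exp (-∑ k ∈ Finset.Ico m n, t k)) :=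
          mul_le_mul_of_nonneg_left ih (by linarith)
        _ ≤ (V m * Real.exp (-∑ k ∈ Finset.Ico m n, t k)) * Real.exp (-t n) := by
          rw [mul_comm]
          exact mul_le_mul_of_nonneg_left hexp (mul_nonneg (hV m) (Real.exp_nonneg _))
  have hlim : Tendsto (fun n => V m * Real.exp (-∑ k ∈ Finset.Ico m n, t k)) atTop (𝓝 0) := by
    have := (Real.tendsto_exp_neg_atTop_nhds_zero.comp (hsum m)).const_mul (V m)
    simpa using this
  obtain ⟨N, hN⟩ := eventually_atTop.1 (hlim.eventually (gt_mem_nhds (half_pos hε)))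
  refine ⟨max m N, fun n hn => ?_⟩
  have h1 := key n ((le_max_left _ _).trans hn.le)
  have h2 := hN n ((le_max_right _ _).trans hn.le)
  rw [Real.dist_eq, sub_zero, abs_of_nonneg (hV n)]
  linarith

theorem tendsto_sum_Ico_atTop {t : ℕ → ℝ} {a : ℝ} (ha : 0 < a)
    (ht : ∀ᶠ n : ℕ in atTop, a / n ≤ t n) (m : ℕ) :
    Tendsto (fun n => ∑ k ∈ Finset.Ico m n, t k) atTop atTop := by
  obtain ⟨N, hN⟩ := eventually_atTop.1 ht
  -- The term `k = 0` is `1 / 0 = 0`, so a shift by one gives the harmonic series.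
  have h1 : Tendsto (fun n => ∑ k ∈ Finset.range n, a * (1 / (k : ℝ))) atTop atTop := by
    simp only [← Finset.mul_sum]
    exact Real.tendsto_sum_range_one_div_nat_succ_atTop.const_mul_atTop ha |> fun h =>
      (tendsto_add_atTop_iff_nat 1).1 (by simpa [Finset.sum_range_succ'] using h)
  have h2 := tendsto_atTop_add_const_right atTop
    (∑ k ∈ Finset.range (max m N), (t k - a * (1 / (k : ℝ))) - ∑ k ∈ Finset.range m, t k) h1
  refine tendsto_atTop_mono' _ ?_ h2
  filter_upwards [eventually_ge_atTop (max m N)] with n hn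
  rw [Finset.sum_Ico_eq_sub _ ((le_max_left _ _).trans hn),
    ← Finset.sum_range_add_sum_Ico t hn,
    ← Finset.sum_range_add_sum_Ico (fun k => a * (1 / (k : ℝ))) hn, Finset.sum_sub_distrib]
  have : ∑ k ∈ Finset.Ico (max m N) n, a * (1 / (k : ℝ)) ≤ ∑ k ∈ Finset.Ico (max m N) n, t k :=
    Finset.sum_le_sum fun k hk => by
      rw [mul_one_div]
      exact hN k ((le_max_right _ _).trans (Finset.mem_Ico.1 hk).1)
  linarith

theorem tendsto_mul_zero_of_abs_le {f g : ℕ → ℝ} {M : ℝ} (hf : ∀ᶠ n in atTop, |f n| ≤ M)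
    (hg : Tendsto g atTop (𝓝 0)) : Tendsto (fun n => f n * g n) atTop (𝓝 0) := by
  refine squeeze_zero_norm' (a := fun n => M * |g n|) ?_ (by simpa using hg.abs.const_mul M)
  filter_upwards [hf] with n hn
  rw [norm_mul, Real.norm_eq_abs, Real.norm_eq_abs]
  exact mul_le_mul_of_nonneg_right hn (abs_nonneg _)

end Deterministic
-- Lyapunov argument for the averages of the proportions.
section Averages

variable {n : Type*} [Fintype n] {A : Matrix n n ℝ} {r : ℝ} {h p : n → ℝ}

theorem exists_lower_upper_bound {x : n → ℝ} (hx : ∀ i, 0 < x i) :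
    ∃ a > 0, ∃ b, ∀ v : n → ℝ, (∀ i, 0 ≤ v i) →
      a * ∑ i, v i ≤ v ⬝ᵥ x ∧ v ⬝ᵥ x ≤ b * ∑ i, v i := by
  obtain ⟨a, ha, hle⟩ := exists_eps_mul_le hx (y := 1)
  refine ⟨a, ha, ∑ i, x i, fun v hv => ⟨?_, ?_⟩⟩
  · rw [Finset.mul_sum]
    refine Finset.sum_le_sum fun i _ => ?_
    have := hle i
    rw [Pi.one_apply, mul_one] at this
    rw [mul_comm]
    exact mul_le_mul_of_nonneg_left this (hv i)
  · rw [Finset.mul_sum]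
    refine Finset.sum_le_sum fun i _ => ?_
    rw [mul_comm]
    exact mul_le_mul_of_nonneg_right
      (Finset.single_le_sum (fun j _ => (hx j).le) (Finset.mem_univ i)) (hv i)

/-- One step of the normalized recursion decreases the quadratic Lyapunov function, up to an
error. -/
theorem IsPerronPair.lyapunov_step {c : ℝ}
    (hgap : ∀ q : n → ℝ, q ⬝ᵥ h = 0 →
      ∑ j, h j / p j * ((q ᵥ* A) j * q j) ≤ (r - c) * ∑ j, h j / p j * q j ^ 2)
    {w w' η : n → ℝ} {θ : ℝ} (hθ : 0 ≤ θ) (hw : w ⬝ᵥ h = 0)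
    (hw' : ∀ j, w' j = w j + θ * ((w ᵥ* A) j - r * w j + η j)) :
    ∑ j, h j / p j * w' j ^ 2 ≤ (1 - 2 * c * θ) * ∑ j, h j / p j * w j ^ 2
      + θ * (2 * ∑ j, h j / p j * (w j * η j)
        + θ * ∑ j, h j / p j * ((w ᵥ* A) j - r * w j + η j) ^ 2) := by
  have e : ∑ j, h j / p j * w' j ^ 2 = ∑ j, h j / p j * w j ^ 2
      + 2 * θ * (∑ j, h j / p j * ((w ᵥ* A) j * w j) - r * ∑ j, h j / p j * w j ^ 2)
      + θ * (2 * ∑ j, h j / p j * (w j * η j)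
        + θ * ∑ j, h j / p j * ((w ᵥ* A) j - r * w j + η j) ^ 2) := by
    simp only [Finset.mul_sum, ← Finset.sum_add_distrib, ← Finset.sum_sub_distrib]
    exact Finset.sum_congr rfl fun j _ => by rw [hw']; ring
  rw [e]
  have := mul_le_mul_of_nonneg_left (hgap w hw) hθ
  linarith

/-- The averages of a sequence `X_n = C_n / S_n` in the simplex converge to the normalized left
Perron eigenvector, if `C_n` is asymptotically the image of the sum of the `X_k`, `k < n`. -/
theorem IsPerronPair.tendsto_average [DecidableEq n] [Nonempty n] (hA : A.IsIrreducible)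
    (hP : IsPerronPair A r h p)
    {X C : ℕ → n → ℝ} (hX0 : ∀ m i, 0 ≤ X m i) (hX1 : ∀ m, ∑ i, X m i = 1)
    (hS : ∀ m, 0 < ∑ i, C m i) (hXC : ∀ m, X m = (∑ i, C m i)⁻¹ • C m)
    (hC : ∀ j, Tendsto (fun m : ℕ => (m : ℝ)⁻¹ *
      (C m j - ((∑ k ∈ Finset.range m, X k) ᵥ* A) j)) atTop (𝓝 0)) (i : n) :
    Tendsto (fun m : ℕ => (m : ℝ)⁻¹ * (∑ k ∈ Finset.range m, X k) i) atTop
      (𝓝 ((∑ i, p i)⁻¹ * p i)) := by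
  obtain ⟨c, hc, hgap⟩ := hP.exists_gap hA
  set U : ℕ → n → ℝ := fun m => ∑ k ∈ Finset.range m, X k with hU
  set S : ℕ → ℝ := fun m => ∑ i, C m i with hSdef
  set e : ℕ → n → ℝ := fun m => C m - U m ᵥ* A with he
  set u : ℕ → ℝ := fun m => U m ⬝ᵥ h with hu
  have hU0 : ∀ m i, 0 ≤ U m i := fun m i => by
    simp only [hU, Finset.sum_apply]; exact Finset.sum_nonneg fun k _ => hX0 k i
  have hUsum : ∀ m, ∑ i, U m i = m := fun m => by
    simp only [hU, Finset.sum_apply]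
    rw [Finset.sum_comm]; simp [hX1]
  have hUsucc : ∀ m, U (m + 1) = U m + X m := fun m => Finset.sum_range_succ _ _
  obtain ⟨hm, hm0, hM, hub⟩ := exists_lower_upper_bound hP.right_pos
  have hul : ∀ m : ℕ, hm * m ≤ u m := fun m => by
    have := (hub (U m) (hU0 m)).1; rwa [hUsum] at this
  have hupos : ∀ m : ℕ, 1 ≤ m → 0 < u m := fun m hm1 =>
    lt_of_lt_of_le (mul_pos hm0 (by exact_mod_cast hm1)) (hul m)
  -- the size of `S`
  have hrow : ∀ i, 0 < ∑ j, A i j := fun i => by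
    obtain ⟨j, hj⟩ := IsIrreducible.exists_pos_entry hA i
    exact Finset.sum_pos' (fun j _ => hA.nonneg i j) ⟨j, Finset.mem_univ j, hj⟩
  obtain ⟨am, am0, aM, hab⟩ := exists_lower_upper_bound hrow
  -- The row sums of `A` are positive and the coordinates of `U m` sum to `m`, so `S m` is of exact
  -- order `m`; hence the steps `θ` are of order `1/m`.
  have hSe : ∀ m, S m = (U m ⬝ᵥ fun i => ∑ j, A i j) + ∑ j, e m j := fun m => by
    simp only [he, Pi.sub_apply, Finset.sum_sub_distrib, Matrix.vecMul, dotProduct, Finset.mul_sum]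
    rw [Finset.sum_comm (f := fun i j => U m i * A i j)]
    simp [hSdef]
  have hen : ∀ j, Tendsto (fun m : ℕ => (m : ℝ)⁻¹ * e m j) atTop (𝓝 0) := hC
  have hesum : Tendsto (fun m : ℕ => (m : ℝ)⁻¹ * ∑ j, e m j) atTop (𝓝 0) := by
    simp only [Finset.mul_sum]
    simpa using tendsto_finsetSum Finset.univ fun j _ => hen j
  have hSb : ∀ᶠ m : ℕ in atTop, am / 2 * m ≤ S m ∧ S m ≤ (aM + am) * m := by
    have h1 := hesum.eventually (Metric.ball_mem_nhds 0 (half_pos am0))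
    filter_upwards [h1, eventually_ge_atTop 1] with m hm1 hm2
    have hmpos : (0 : ℝ) < m := by exact_mod_cast hm2
    rw [Real.dist_eq, sub_zero, abs_lt, inv_mul_eq_div, lt_div_iff₀ hmpos,
      div_lt_iff₀ hmpos] at hm1
    have h2 := hab (U m) (hU0 m)
    rw [hUsum] at h2
    rw [hSe]
    constructor <;> nlinarith
  -- the relative errors
  have heu : ∀ j, Tendsto (fun m => e m j / u m) atTop (𝓝 0) := by
    intro j
    have h1 : ∀ᶠ m : ℕ in atTop, |(m : ℝ) / u m| ≤ hm⁻¹ := by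
      filter_upwards [eventually_ge_atTop 1] with m hm1
      rw [abs_of_nonneg (div_nonneg m.cast_nonneg (hupos m hm1).le), div_le_iff₀ (hupos m hm1),
        inv_mul_eq_div, le_div_iff₀ hm0, mul_comm]
      exact hul m
    refine (tendsto_mul_zero_of_abs_le h1 (hen j)).congr' ?_
    filter_upwards [eventually_ge_atTop 1] with m hm1
    have : (m : ℝ) ≠ 0 := by positivity
    field_simp
  set ε : ℕ → ℝ := fun m => (e m ⬝ᵥ h) / u m with hε
  have hεlim : Tendsto ε atTop (𝓝 0) := by
    have : ε = fun m => ∑ j, e m j / u m * h j := by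
      ext m; simp only [hε, dotProduct, Finset.sum_div]
      exact Finset.sum_congr rfl fun j _ => by ring
    rw [this]
    simpa using tendsto_finsetSum Finset.univ fun j _ => (heu j).mul_const (h j)
  -- Normalizing by `u = U · h` rather than by `m` gives `a · h = 1 = p · h`, so the deviation `w =
  -- a - p` lies exactly in the hyperplane where the gap holds.
  set a : ℕ → n → ℝ := fun m j => U m j / u m with ha
  have ha0 : ∀ m, 1 ≤ m → ∀ j, 0 ≤ a m j := fun m hm1 j => div_nonneg (hU0 m j) (hupos m hm1).le
  have hah : ∀ m, 1 ≤ m → a m ⬝ᵥ h = 1 := fun m hm1 => by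
    have : a m ⬝ᵥ h = u m / u m := by
      simp only [ha, hu, dotProduct, Finset.sum_div]
      exact Finset.sum_congr rfl fun j _ => by ring
    rw [this, div_self (hupos m hm1).ne']
  have hab' : ∀ m, 1 ≤ m → ∀ j, |a m j| ≤ hm⁻¹ := fun m hm1 j => by
    rw [abs_of_nonneg (ha0 m hm1 j)]
    have h1 := (hub (a m) (ha0 m hm1)).1
    rw [hah m hm1] at h1
    have h2 := Finset.single_le_sum (fun k _ => ha0 m hm1 k) (Finset.mem_univ j)
    rw [← one_div, le_div_iff₀ hm0, mul_comm]
    exact (mul_le_mul_of_nonneg_left h2 hm0.le).trans h1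
  set η : ℕ → n → ℝ := fun m j => e m j / u m - a m j * ε m with hη
  have hηlim : ∀ j, Tendsto (fun m => η m j) atTop (𝓝 0) := fun j => by
    simpa using (heu j).sub (tendsto_mul_zero_of_abs_le
      ((eventually_ge_atTop 1).mono fun m hm1 => hab' m hm1 j) hεlim)
  -- From `U_{m+1} = U_m + S_m⁻¹ (U_m A + e_m)` one gets `u_{m+1} = u_m (S_m + r + ε_m) / S_m`;
  -- dividing leaves this step size in the recursion for `a`.
  set θ : ℕ → ℝ := fun m => (S m + r + ε m)⁻¹ with hθ
  set w : ℕ → n → ℝ := fun m j => a m j - p j with hw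
  have hwb : ∀ j, ∀ᶠ m in atTop, |w m j| ≤ hm⁻¹ + |p j| := fun j =>
    (eventually_ge_atTop 1).mono fun m hm1 =>
      (abs_sub _ _).trans (add_le_add (hab' m hm1 j) le_rfl)
  have hεb : ∀ᶠ m in atTop, -r < ε m ∧ ε m < 1 :=
    (hεlim.eventually (lt_mem_nhds (neg_lt_zero.2 hP.pos))).and
      (hεlim.eventually (gt_mem_nhds one_pos))
  have haM : 0 < aM + am := by
    have h1 := hab (X 0) (hX0 0)
    rw [hX1] at h1
    linarith [h1.1.trans h1.2]
  have hr := hP.pos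
  have hθl : ∀ᶠ m : ℕ in atTop, (aM + am + r + 1)⁻¹ / m ≤ θ m := by
    filter_upwards [hSb, hεb, eventually_ge_atTop 1] with m h1 h2 hm1
    have hm1' : (1 : ℝ) ≤ m := by exact_mod_cast hm1
    rw [inv_eq_one_div, div_div, one_div]
    refine inv_anti₀ (by linarith [hS m]) ?_
    nlinarith
  have hθ0 : Tendsto θ atTop (𝓝 0) := by
    refine tendsto_inv_atTop_zero.comp ?_
    have h1 : Tendsto (fun m : ℕ => am / 2 * (m : ℝ)) atTop atTop :=
      tendsto_natCast_atTop_atTop.const_mul_atTop (half_pos am0)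
    refine tendsto_atTop_mono' _ ?_ h1
    filter_upwards [hSb, hεb] with m h1 h2
    linarith
  have hθnn : ∀ᶠ m in atTop, 0 ≤ θ m := by
    filter_upwards [hεb] with m h2
    exact inv_nonneg.2 (by linarith [hS m])
  have hstep : ∀ᶠ m in atTop, ∀ j,
      w (m + 1) j = w m j + θ m * ((w m ᵥ* A) j - r * w m j + η m j) := by
    filter_upwards [hεb, eventually_ge_atTop 1] with m h2 hm1 j
    have hSm := hS m
    have hum := hupos m hm1
    have hX : ∀ j, X m j = (S m)⁻¹ * ((U m ᵥ* A) j + e m j) := fun j => by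
      rw [hXC]; simp [he, hSdef]
    have husucc : u (m + 1) = u m * (S m + r + ε m) / S m := by
      have h3 : (U m ᵥ* A) ⬝ᵥ h = r * u m := by
        rw [← Matrix.dotProduct_mulVec, hP.right_eq, dotProduct_smul, smul_eq_mul]
      have h4 : X m ⬝ᵥ h = (S m)⁻¹ * (r * u m + e m ⬝ᵥ h) := by
        rw [← h3, ← add_dotProduct, ← smul_eq_mul, ← smul_dotProduct]
        congr 1
        exact funext hX
      have h5 : u (m + 1) = u m + X m ⬝ᵥ h := by simp only [hu]; rw [hUsucc, add_dotProduct]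
      rw [h5, h4]
      simp only [hε]
      have : S m ≠ 0 := hSm.ne'
      have : u m ≠ 0 := hum.ne'
      field_simp
      ring
    have hwA : (w m ᵥ* A) j = (U m ᵥ* A) j / u m - r * p j := by
      have h5 : w m = (u m)⁻¹ • U m - p := by
        ext j; simp [hw, ha, div_eq_inv_mul]
      rw [h5, Matrix.sub_vecMul, Matrix.smul_vecMul, hP.left_eq]
      simp [div_eq_inv_mul]
    have h6 : S m + r + ε m ≠ 0 := by linarith [h2.1]
    rw [hwA]
    simp only [hw, ha, hη, hθ]
    rw [husucc, hUsucc, Pi.add_apply, hX]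
    have : S m ≠ 0 := hSm.ne'
    have : u m ≠ 0 := hum.ne'
    field_simp
    ring
  have hwh : ∀ m, 1 ≤ m → w m ⬝ᵥ h = 0 := fun m hm1 => by
    rw [show w m = a m - p from rfl, sub_dotProduct, hah m hm1, hP.dot_eq, sub_self]
  -- The error of `lyapunov_step` per unit of `θ`: the first part vanishes because `w` is bounded
  -- and `η → 0`, the second because the drift is bounded and `θ → 0`.
  set κ : ℕ → ℝ := fun m => 2 * ∑ j, h j / p j * (w m j * η m j)
        + θ m * ∑ j, h j / p j * ((w m ᵥ* A) j - r * w m j + η m j) ^ 2 with hκ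
  have hκlim : Tendsto κ atTop (𝓝 0) := by
    have h1 : Tendsto (fun m => ∑ j, h j / p j * (w m j * η m j)) atTop (𝓝 0) := by
      simpa using tendsto_finsetSum Finset.univ fun j _ =>
        (tendsto_mul_zero_of_abs_le (hwb j) (hηlim j)).const_mul (h j / p j)
    have hgb : ∀ j, ∃ M, ∀ᶠ m in atTop, |(w m ᵥ* A) j - r * w m j + η m j| ≤ M := by
      intro j
      refine ⟨∑ k, (hm⁻¹ + |p k|) * |A k j| + r * (hm⁻¹ + |p j|) + 1, ?_⟩
      filter_upwards [eventually_all.2 hwb,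
        (hηlim j).eventually (Metric.ball_mem_nhds 0 one_pos)] with m h3 h4
      rw [Real.dist_eq, sub_zero] at h4
      refine (abs_add_le _ _).trans (add_le_add ((abs_sub _ _).trans (add_le_add ?_ ?_)) h4.le)
      · refine (Finset.abs_sum_le_sum_abs _ _).trans (Finset.sum_le_sum fun k _ => ?_)
        rw [abs_mul]
        exact mul_le_mul_of_nonneg_right (h3 k) (abs_nonneg _)
      · rw [abs_mul, abs_of_pos hr]
        exact mul_le_mul_of_nonneg_left (h3 j) hr.le
    have h2 : Tendsto (fun m => θ m * ∑ j, h j / p j * ((w m ᵥ* A) j - r * w m j + η m j) ^ 2)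
        atTop (𝓝 0) := by
      choose M hM' using hgb
      have h3 : ∀ᶠ m in atTop, |∑ j, h j / p j * ((w m ᵥ* A) j - r * w m j + η m j) ^ 2| ≤
          ∑ j, |h j / p j| * M j ^ 2 := by
        filter_upwards [eventually_all.2 hM'] with m h4
        refine (Finset.abs_sum_le_sum_abs _ _).trans (Finset.sum_le_sum fun k _ => ?_)
        rw [abs_mul, abs_pow]
        gcongr
        exact h4 k
      simpa only [mul_comm] using tendsto_mul_zero_of_abs_le h3 hθ0
    simpa [hκ] using (h1.const_mul 2).add h2
  have hd : ∀ j, 0 < h j / p j := fun j => div_pos (hP.right_pos j) (hP.left_pos j)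
  have hV : Tendsto (fun m => ∑ j, h j / p j * w m j ^ 2) atTop (𝓝 0) := by
    refine tendsto_zero_of_contraction (t := fun m => 2 * c * θ m) (κ := fun m => κ m / (2 * c))
      (fun m => Finset.sum_nonneg fun j _ => mul_nonneg (hd j).le (sq_nonneg _)) ?_ ?_
      (by simpa using hκlim.div_const (2 * c)) ?_
    · filter_upwards [hθnn,
        (by simpa using hθ0.const_mul (2 * c) :
          Tendsto (fun m => 2 * c * θ m) atTop (𝓝 0)).eventually (gt_mem_nhds one_pos)] with m h1 h2
      exact ⟨by positivity, h2.le⟩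
    · refine tendsto_sum_Ico_atTop (a := 2 * c * (aM + am + r + 1)⁻¹) (by positivity) ?_
      filter_upwards [hθl] with m h1
      rw [mul_div_assoc]
      exact mul_le_mul_of_nonneg_left h1 (by positivity)
    · filter_upwards [hθnn, hstep, eventually_ge_atTop 1] with m h1 h2 hm1
      refine (lyapunov_step hgap h1 (hwh m hm1) h2).trans (le_of_eq ?_)
      simp only [hκ]
      field_simp
  have hwlim : ∀ j, Tendsto (fun m => w m j) atTop (𝓝 0) := by
    intro j
    have h1 : Tendsto (fun m => w m j ^ 2) atTop (𝓝 0) := by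
      refine squeeze_zero (fun m => sq_nonneg _) (fun m => ?_)
        (by simpa only [mul_zero] using hV.const_mul (h j / p j)⁻¹)
      rw [inv_mul_eq_div, le_div_iff₀ (hd j), mul_comm]
      exact Finset.single_le_sum (f := fun j => h j / p j * w m j ^ 2)
        (fun k _ => mul_nonneg (hd k).le (sq_nonneg _)) (Finset.mem_univ j)
    have h2 := h1.sqrt
    simp only [Real.sqrt_sq_eq_abs, Real.sqrt_zero] at h2
    exact (tendsto_zero_iff_abs_tendsto_zero _).2 h2
  have halim : ∀ j, Tendsto (fun m => a m j) atTop (𝓝 (p j)) := fun j => by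
    simpa [hw] using (hwlim j).add_const (p j)
  have hs : 0 < ∑ i, p i := Finset.sum_pos (fun i _ => hP.left_pos i) Finset.univ_nonempty
  -- Rescaling `a` to total mass one cancels `u` and restores the average, since the coordinates of
  -- `U m` sum to `m`.
  have h1 := ((tendsto_finsetSum Finset.univ fun j _ => halim j).inv₀ hs.ne').mul (halim i)
  refine h1.congr' ?_
  filter_upwards [eventually_ge_atTop 1] with m hm1
  have : u m ≠ 0 := (hupos m hm1).ne'
  have : (m : ℝ) ≠ 0 := by positivity
  simp only [ha, ← Finset.sum_div, hUsum]
  field_simp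
  rfl

end Averages
-- A strong law for dominated sequences.
section StrongLaw

/-- **Kronecker's lemma** with the weights `k + 1`. -/
theorem tendsto_average_of_tendsto_sum_div {x : ℕ → ℝ} {l : ℝ}
    (h : Tendsto (fun n => ∑ k ∈ Finset.range n, x k / ((k : ℝ) + 1)) atTop (𝓝 l)) :
    Tendsto (fun n : ℕ => (n : ℝ)⁻¹ * ∑ k ∈ Finset.range n, x k) atTop (𝓝 0) := by
  set T : ℕ → ℝ := fun n => ∑ k ∈ Finset.range n, x k / ((k : ℝ) + 1) with hT
  -- Summation by parts: the average of `x` becomes `T n` minus the Cesàro mean of `T`, and both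
  -- tend to `l`.
  have habel : ∀ n : ℕ, ∑ k ∈ Finset.range n, x k = n * T n - ∑ k ∈ Finset.range n, T k := by
    intro n
    induction n with
    | zero => simp
    | succ n ih =>
      have h1 : T (n + 1) = T n + x n / ((n : ℝ) + 1) := Finset.sum_range_succ _ _
      have h2 : (n : ℝ) + 1 ≠ 0 := by positivity
      rw [Finset.sum_range_succ, Finset.sum_range_succ, ih, h1]
      push_cast
      field_simp
      ring
  have h1 : Tendsto (fun n : ℕ => T n - (n : ℝ)⁻¹ * ∑ k ∈ Finset.range n, T k) atTop (𝓝 0) := by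
    simpa using h.sub h.cesaro
  refine h1.congr' ?_
  filter_upwards [eventually_ge_atTop 1] with n hn
  have : (n : ℝ) ≠ 0 := by positivity
  rw [habel]
  field_simp

variable {Ω : Type*} {mΩ : MeasurableSpace Ω} {μ : Measure Ω}

theorem ae_summable_of_summable_integral_abs {f : ℕ → Ω → ℝ} (hf : ∀ k, Integrable (f k) μ)
    (hs : Summable fun k => ∫ ω, |f k ω| ∂μ) : ∀ᵐ ω ∂μ, Summable fun k => f k ω := by
  have h1 : ∫⁻ ω, ∑' k, ‖f k ω‖ₑ ∂μ ≠ ⊤ := by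
    rw [lintegral_tsum fun k => (hf k).1.enorm]
    have : ∀ k, ∫⁻ ω, ‖f k ω‖ₑ ∂μ = ENNReal.ofReal (∫ ω, |f k ω| ∂μ) := fun k => by
      rw [← ofReal_integral_norm_eq_lintegral_enorm (hf k)]; rfl
    simp only [this]
    exact hs.tsum_ofReal_ne_top
  filter_upwards [ae_lt_top' (AEMeasurable.tsum fun k => (hf k).1.enorm) h1] with ω hω
  refine Summable.of_norm ?_
  have h2 : Summable fun k => ‖f k ω‖₊ := ENNReal.tsum_coe_ne_top_iff_summable.1 hω.ne
  exact NNReal.summable_coe.2 h2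

theorem integrable_of_ae_abs_le [IsFiniteMeasure μ] {f : Ω → ℝ} (hf : AEStronglyMeasurable f μ)
    {c : ℝ} (hc : ∀ᵐ ω ∂μ, |f ω| ≤ c) : Integrable f μ :=
  (integrable_const c).mono' hf hc

theorem condExp_sub_condExp {m : MeasurableSpace Ω} (hm : m ≤ mΩ) [IsFiniteMeasure μ]
    {f : Ω → ℝ} (hf : Integrable f μ) : μ[f - μ[f | m] | m] =ᵐ[μ] 0 := by
  filter_upwards [condExp_sub hf (integrable_condExp (m := m) (f := f)) m] with ω h1
  rw [h1, condExp_of_stronglyMeasurable hm stronglyMeasurable_condExp integrable_condExp, sub_self]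

theorem integral_mul_eq_zero_of_condExp_eq_zero {m : MeasurableSpace Ω} (hm : m ≤ mΩ)
    [IsFiniteMeasure μ] {f g : Ω → ℝ} {c : ℝ} (hf : StronglyMeasurable[m] f)
    (hfc : ∀ᵐ ω ∂μ, |f ω| ≤ c) (hg : Integrable g μ) (h0 : μ[g | m] =ᵐ[μ] 0) :
    ∫ ω, f ω * g ω ∂μ = 0 := by
  have h1 := condExp_stronglyMeasurable_mul_of_bound hm hf hg c hfc
  have h2 : μ[f * g | m] =ᵐ[μ] 0 := by
    filter_upwards [h1, h0] with ω h3 h4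
    rw [h3, Pi.mul_apply, h4, Pi.zero_apply, mul_zero]
  have h3 := integral_condExp (μ := μ) hm (f := f * g)
  rw [integral_congr_ae h2] at h3
  simpa using h3.symm

/-- Pythagoras: `f - E(f | m)` is orthogonal to `E(f | m)`. Boundedness makes every product
integrable. -/
theorem integral_sub_condExp_sq_le {m : MeasurableSpace Ω} (hm : m ≤ mΩ) [IsFiniteMeasure μ]
    {f : Ω → ℝ} {c : ℝ} (hf : AEStronglyMeasurable[mΩ] f μ) (hfc : ∀ᵐ ω ∂μ, |f ω| ≤ c) :
    ∫ ω, (f ω - μ[f | m] ω) ^ 2 ∂μ ≤ ∫ ω, f ω ^ 2 ∂μ := by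
  have hfi := integrable_of_ae_abs_le hf hfc
  have hE : ∀ᵐ ω ∂μ, |μ[f | m] ω| ≤ c := ae_bdd_abs_condExp_of_ae_bdd_abs hfc
  have hEm : StronglyMeasurable[m] (μ[f | m]) := stronglyMeasurable_condExp
  have h0 := integral_mul_eq_zero_of_condExp_eq_zero hm hEm hE (hfi.sub integrable_condExp)
    (condExp_sub_condExp hm hfi)
  have hEm' : AEStronglyMeasurable[mΩ] (μ[f | m]) μ := (hEm.mono hm).aestronglyMeasurable
  have i1 : Integrable (fun ω => (f ω - μ[f | m] ω) ^ 2) μ := by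
    refine integrable_of_ae_abs_le ((hf.sub hEm').pow 2) (c := (2 * c) ^ 2) ?_
    filter_upwards [hfc, hE] with ω h1 h2
    rw [abs_pow]
    have := (abs_sub (f ω) (μ[f | m] ω))
    gcongr
    linarith
  have i2 : Integrable (fun ω => μ[f | m] ω ^ 2) μ := by
    refine integrable_of_ae_abs_le (hEm'.pow 2) (c := c ^ 2) ?_
    filter_upwards [hE] with ω h2
    rw [abs_pow]
    gcongr
  have i3 : Integrable (fun ω => μ[f | m] ω * (f ω - μ[f | m] ω)) μ := by
    refine integrable_of_ae_abs_le (hEm'.mul (hf.sub hEm')) (c := c * (2 * c)) ?_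
    filter_upwards [hfc, hE] with ω h1 h2
    rw [abs_mul]
    have := abs_sub (f ω) (μ[f | m] ω)
    exact mul_le_mul h2 (by linarith) (abs_nonneg _) ((abs_nonneg _).trans h1)
  have e : ∫ ω, f ω ^ 2 ∂μ = ∫ ω, (f ω - μ[f | m] ω) ^ 2 ∂μ + ∫ ω, μ[f | m] ω ^ 2 ∂μ
      + 2 * ∫ ω, μ[f | m] ω * (f ω - μ[f | m] ω) ∂μ := by
    have i12 : Integrable (fun ω => (f ω - μ[f | m] ω) ^ 2 + μ[f | m] ω ^ 2) μ := i1.add i2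
    rw [← integral_const_mul, ← integral_add i1 i2, ← integral_add i12 (i3.const_mul 2)]
    exact integral_congr_ae (ae_of_all _ fun ω => by ring)
  rw [e, show ∫ ω, μ[f | m] ω * (f ω - μ[f | m] ω) ∂μ = 0 from h0]
  have : 0 ≤ ∫ ω, μ[f | m] ω ^ 2 ∂μ := integral_nonneg fun ω => sq_nonneg _
  linarith

/-- A series of bounded martingale differences with summable second moments converges almost
surely. -/
theorem ae_exists_tendsto_sum_of_summable_sq [IsProbabilityMeasure μ] (ℱ : Filtration ℕ mΩ)
    {d : ℕ → Ω → ℝ} {c : ℕ → ℝ} (hd : ∀ k, StronglyMeasurable[ℱ (k + 1)] (d k))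
    (hdc : ∀ k, ∀ᵐ ω ∂μ, |d k ω| ≤ c k) (hd0 : ∀ k, μ[d k | ℱ k] =ᵐ[μ] 0)
    (hs : Summable fun k => ∫ ω, d k ω ^ 2 ∂μ) :
    ∀ᵐ ω ∂μ, ∃ l, Tendsto (fun n => ∑ k ∈ Finset.range n, d k ω) atTop (𝓝 l) := by
  set M : ℕ → Ω → ℝ := fun n ω => ∑ k ∈ Finset.range n, d k ω with hM
  have hMs : ∀ n, M (n + 1) = M n + d n := fun n => by
    ext ω; exact Finset.sum_range_succ _ _
  have hMm : ∀ n, StronglyMeasurable[ℱ n] (M n) := fun n => by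
    refine Finset.stronglyMeasurable_fun_sum _ fun k hk => ?_
    exact (hd k).mono (ℱ.mono (Finset.mem_range.1 hk))
  have hMm' : ∀ n, AEStronglyMeasurable (M n) μ := fun n =>
    ((hMm n).mono (ℱ.le n)).aestronglyMeasurable
  have hdm : ∀ n, AEStronglyMeasurable (d n) μ := fun n =>
    ((hd n).mono (ℱ.le _)).aestronglyMeasurable
  have hMc : ∀ n, ∀ᵐ ω ∂μ, |M n ω| ≤ ∑ k ∈ Finset.range n, c k := fun n => by
    filter_upwards [ae_all_iff.2 hdc] with ω hω
    exact (Finset.abs_sum_le_sum_abs _ _).trans (Finset.sum_le_sum fun k _ => hω k)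
  have hdi : ∀ k, Integrable (d k) μ := fun k => integrable_of_ae_abs_le (hdm k) (hdc k)
  have hMi : ∀ k, Integrable (M k) μ := fun k => integrable_of_ae_abs_le (hMm' k) (hMc k)
  have hsqi : ∀ {f : Ω → ℝ} {b : ℝ}, AEStronglyMeasurable f μ → (∀ᵐ ω ∂μ, |f ω| ≤ b) →
      Integrable (fun ω => f ω ^ 2) μ := fun {f b} hf hb => by
    refine integrable_of_ae_abs_le (hf.pow 2) (c := b ^ 2) ?_
    filter_upwards [hb] with ω h
    rw [abs_pow]; gcongr
  have hmart : Martingale M ℱ μ := by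
    refine martingale_of_condExp_sub_eq_zero_nat hMm hMi fun n => ?_
    rw [hMs, add_sub_cancel_left]
    exact hd0 n
  -- Martingale differences are orthogonal. With `|x| ≤ 1 + x²` this bounds the martingale in `L¹`,
  -- as its convergence theorem requires.
  have hsq : ∀ n, ∫ ω, M n ω ^ 2 ∂μ = ∑ k ∈ Finset.range n, ∫ ω, d k ω ^ 2 ∂μ := by
    intro n
    induction n with
    | zero => simp [hM]
    | succ n ih =>
      have h0 := integral_mul_eq_zero_of_condExp_eq_zero (ℱ.le n) (hMm n) (hMc n) (hdi n) (hd0 n)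
      have i3 : Integrable (fun ω => M n ω * d n ω) μ :=
        (hdi n).bdd_mul (hMm' n) (hMc n)
      have e : ∫ ω, M (n + 1) ω ^ 2 ∂μ = ∫ ω, M n ω ^ 2 ∂μ + ∫ ω, d n ω ^ 2 ∂μ
          + 2 * ∫ ω, M n ω * d n ω ∂μ := by
        have i12 : Integrable (fun ω => M n ω ^ 2 + d n ω ^ 2) μ :=
          (hsqi (hMm' n) (hMc n)).add (hsqi (hdm n) (hdc n))
        rw [← integral_const_mul, ← integral_add (hsqi (hMm' n) (hMc n)) (hsqi (hdm n) (hdc n)),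
          ← integral_add i12 (i3.const_mul 2), hMs]
        exact integral_congr_ae (ae_of_all _ fun ω => by simp only [Pi.add_apply]; ring)
      rw [e, h0, ih, Finset.sum_range_succ, mul_zero, add_zero]
  refine hmart.submartingale.exists_ae_tendsto_of_bdd
    (R := Real.toNNReal (1 + ∑' k, ∫ ω, d k ω ^ 2 ∂μ)) fun n => ?_
  rw [eLpNorm_one_eq_lintegral_enorm, ← ofReal_integral_norm_eq_lintegral_enorm (hMi n)]
  refine ENNReal.ofReal_le_ofReal ?_
  calc ∫ ω, ‖M n ω‖ ∂μ ≤ ∫ ω, (1 + M n ω ^ 2) ∂μ := by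
        refine integral_mono (hMi n).norm ((integrable_const 1).add (hsqi (hMm' n) (hMc n)))
          fun ω => ?_
        simp only [Real.norm_eq_abs]
        nlinarith [sq_nonneg (|M n ω| - 1), sq_abs (M n ω), abs_nonneg (M n ω)]
    _ = 1 + ∑ k ∈ Finset.range n, ∫ ω, d k ω ^ 2 ∂μ := by
        rw [integral_add (integrable_const 1) (hsqi (hMm' n) (hMc n)), hsq]; simp
    _ ≤ _ := by
        gcongr
        exact hs.sum_le_tsum _ fun k _ => integral_nonneg fun ω => sq_nonneg _

/-- **Strong law of large numbers for dominated sequences**: the averages of `Z_k - E(Z_k | ℱ_k)`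
tend to zero almost surely, if the dominating variables satisfy two truncated moment conditions. -/
theorem ae_tendsto_average_sub_condExp [IsProbabilityMeasure μ] (ℱ : Filtration ℕ mΩ)
    {Z ρ : ℕ → Ω → ℝ} (hZ : ∀ k, Measurable[ℱ (k + 1)] (Z k))
    (hρ : ∀ k, Measurable[ℱ (k + 1)] (ρ k)) (hρi : ∀ k, Integrable (ρ k) μ)
    (hZρ : ∀ k, ∀ᵐ ω ∂μ, |Z k ω| ≤ ρ k ω)
    (h1 : Summable fun k : ℕ => (∫ ω, {ω | (k : ℝ) + 1 < ρ k ω}.indicator (ρ k) ω ∂μ) / ((k : ℝ) + 1))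
    (h2 : Summable fun k : ℕ => (∫ ω, {ω | (k : ℝ) + 1 < ρ k ω}ᶜ.indicator (fun ω => ρ k ω ^ 2) ω ∂μ)
      / ((k : ℝ) + 1) ^ 2) :
    ∀ᵐ ω ∂μ, Tendsto (fun n : ℕ => (n : ℝ)⁻¹ *
      ∑ k ∈ Finset.range n, (Z k ω - μ[Z k | ℱ k] ω)) atTop (𝓝 0) := by
  set s : ℕ → Set Ω := fun k => {ω | (k : ℝ) + 1 < ρ k ω} with hs
  have hsm : ∀ k, MeasurableSet[ℱ (k + 1)] (s k) := fun k => hρ k measurableSet_Ioi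
  have hsm' : ∀ k, MeasurableSet (s k) := fun k => ℱ.le _ _ (hsm k)
  have hZm : ∀ k, Measurable (Z k) := fun k => (hZ k).mono (ℱ.le _) le_rfl
  have hρm : ∀ k, Measurable (ρ k) := fun k => (hρ k).mono (ℱ.le _) le_rfl
  have hZi : ∀ k, Integrable (Z k) μ := fun k =>
    (hρi k).mono' (hZm k).aestronglyMeasurable (hZρ k)
  -- Truncation is decided by `ρ k` rather than by `Z k`, so that the two moment conditions apply
  -- directly. The parts `V` and their conditional expectations, divided by `k + 1`, are absolutely
  -- summable; the parts `W` give bounded martingale differences.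
  set W : ℕ → Ω → ℝ := fun k => (s k)ᶜ.indicator (Z k) with hW
  set V : ℕ → Ω → ℝ := fun k => (s k).indicator (Z k) with hV
  have hWi : ∀ k, Integrable (W k) μ := fun k => (hZi k).indicator (hsm' k).compl
  have hVi : ∀ k, Integrable (V k) μ := fun k => (hZi k).indicator (hsm' k)
  have hWb : ∀ k, ∀ᵐ ω ∂μ, |W k ω| ≤ (k : ℝ) + 1 := fun k => by
    filter_upwards [hZρ k] with ω h
    by_cases hω : ω ∈ s k
    · simp only [hW]
      rw [Set.indicator_of_notMem (Set.notMem_compl_iff.2 hω), abs_zero]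
      positivity
    · simp only [hW]
      rw [Set.indicator_of_mem (Set.mem_compl hω)]
      have : ρ k ω ≤ k + 1 := not_lt.1 hω
      linarith
  have hdecomp : ∀ k, ∀ᵐ ω ∂μ, Z k ω - μ[Z k | ℱ k] ω =
      (W k ω - μ[W k | ℱ k] ω) + (V k ω - μ[V k | ℱ k] ω) := fun k => by
    have h3 : Z k = W k + V k := (Set.indicator_compl_add_self _ _).symm
    filter_upwards [condExp_add (hWi k) (hVi k) (ℱ k)] with ω h4
    rw [h3, h4]
    simp only [Pi.add_apply]
    ring
  have hpos : ∀ k : ℕ, (0 : ℝ) < (k : ℝ) + 1 := fun k => by positivity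
  -- the large parts
  have hVabs : ∀ k, ∫ ω, |V k ω| ∂μ ≤ ∫ ω, (s k).indicator (ρ k) ω ∂μ := fun k => by
    refine integral_mono_ae (hVi k).abs ((hρi k).indicator (hsm' k)) ?_
    filter_upwards [hZρ k] with ω h
    simp only [hV, Set.indicator_apply]
    split_ifs
    · exact h
    · simp
  have hVsum : ∀ᵐ ω ∂μ, Summable fun k : ℕ => V k ω / ((k : ℝ) + 1) := by
    refine ae_summable_of_summable_integral_abs (fun k => (hVi k).div_const _) ?_
    refine Summable.of_nonneg_of_le (fun k => integral_nonneg fun ω => abs_nonneg _) (fun k => ?_) h1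
    simp only [abs_div, abs_of_pos (hpos k), integral_div]
    exact div_le_div_of_nonneg_right (hVabs k) (hpos k).le
  have hEsum : ∀ᵐ ω ∂μ, Summable fun k : ℕ => μ[V k | ℱ k] ω / ((k : ℝ) + 1) := by
    refine ae_summable_of_summable_integral_abs (fun k => integrable_condExp.div_const _) ?_
    refine Summable.of_nonneg_of_le (fun k => integral_nonneg fun ω => abs_nonneg _) (fun k => ?_) h1
    simp only [abs_div, abs_of_pos (hpos k), integral_div]
    exact div_le_div_of_nonneg_right ((integral_abs_condExp_le _).trans (hVabs k)) (hpos k).le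
  -- the truncated parts
  set d : ℕ → Ω → ℝ := fun k ω => ((k : ℝ) + 1)⁻¹ * (W k ω - μ[W k | ℱ k] ω) with hd
  have hdsum : ∀ᵐ ω ∂μ, ∃ l, Tendsto (fun n => ∑ k ∈ Finset.range n, d k ω) atTop (𝓝 l) := by
    refine ae_exists_tendsto_sum_of_summable_sq ℱ (c := fun _ => 2) (fun k => ?_) (fun k => ?_)
      (fun k => ?_) ?_
    · have h3 : StronglyMeasurable[ℱ (k + 1)] (W k) :=
        ((hZ k).indicator (hsm k).compl).stronglyMeasurable
      have h4 : StronglyMeasurable[ℱ (k + 1)] (μ[W k | ℱ k]) :=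
        stronglyMeasurable_condExp.mono (ℱ.mono (Nat.le_succ k))
      exact (h3.sub h4).const_mul _
    · filter_upwards [hWb k, ae_bdd_abs_condExp_of_ae_bdd_abs (m := ℱ k) (hWb k)] with ω h3 h4
      simp only [hd]
      rw [abs_mul, abs_of_pos (inv_pos.2 (hpos k)), inv_mul_le_iff₀ (hpos k)]
      linarith [abs_sub (W k ω) (μ[W k | ℱ k] ω)]
    · have h3 := condExp_smul (μ := μ) (((k : ℝ) + 1)⁻¹) (W k - μ[W k | ℱ k]) (ℱ k)
      filter_upwards [h3, condExp_sub_condExp (ℱ.le k) (hWi k)] with ω h4 h5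
      refine h4.trans ?_
      rw [Pi.smul_apply, h5, Pi.zero_apply, smul_zero]
    · refine Summable.of_nonneg_of_le (fun k => integral_nonneg fun ω => sq_nonneg _)
        (fun k => ?_) h2
      simp only [hd, mul_pow]
      rw [integral_const_mul, inv_pow, inv_mul_eq_div]
      refine div_le_div_of_nonneg_right ((integral_sub_condExp_sq_le (ℱ.le k)
        (hWi k).1 (hWb k)).trans ?_) (by positivity)
      refine integral_mono_of_nonneg (ae_of_all _ fun ω => sq_nonneg _) ?_ ?_
      · refine integrable_of_ae_abs_le (c := ((k : ℝ) + 1) ^ 2)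
          (((hρm k).pow_const 2).indicator (hsm' k).compl).aestronglyMeasurable ?_
        filter_upwards [hZρ k] with ω h3
        by_cases hω : ω ∈ s k
        · rw [Set.indicator_of_notMem (Set.notMem_compl_iff.2 hω), abs_zero]
          positivity
        · rw [Set.indicator_of_mem (Set.mem_compl hω), abs_pow]
          have h5 : ρ k ω ≤ k + 1 := not_lt.1 hω
          have h6 : 0 ≤ ρ k ω := (abs_nonneg _).trans h3
          rw [abs_of_nonneg h6]
          gcongr
      · filter_upwards [hZρ k] with ω h3
        simp only [hW, Set.indicator_apply]
        split_ifs
        · rw [← sq_abs]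
          gcongr
        · simp
  filter_upwards [hdsum, hVsum, hEsum, ae_all_iff.2 hdecomp] with ω ⟨l, h3⟩ h4 h5 h6
  refine tendsto_average_of_tendsto_sum_div
    (((h3.add h4.hasSum.tendsto_sum_nat).sub h5.hasSum.tendsto_sum_nat).congr fun n => ?_)
  rw [← Finset.sum_add_distrib, ← Finset.sum_sub_distrib]
  refine Finset.sum_congr rfl fun k _ => ?_
  rw [h6]
  simp only [hd]
  ring

end StrongLaw
-- The row-sum norm: measurability and bounds on entries.
section MatrixNorm

variable {K : ℕ}

theorem measurable_matrix_entry (i j : Fin K) :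
    Measurable fun A : Matrix (Fin K) (Fin K) ℝ => A i j :=
  (measurable_pi_apply j).comp (measurable_pi_apply (X := fun _ : Fin K => Fin K → ℝ) i)

theorem measurable_matrix_nnnorm : Measurable fun A : Matrix (Fin K) (Fin K) ℝ => ‖A‖₊ := by
  simp only [Matrix.linfty_opNNNorm_def]
  suffices h : ∀ s : Finset (Fin K), Measurable fun A : Matrix (Fin K) (Fin K) ℝ =>
      s.sup fun i => ∑ j, ‖A i j‖₊ from h _
  intro s
  induction s using Finset.induction_on with
  | empty => simp
  | insert i s _ ih =>
    simp only [Finset.sup_insert]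
    exact Measurable.sup
      (Finset.measurable_fun_sum _ fun j _ => (measurable_matrix_entry i j).nnnorm) ih

theorem sum_abs_entry_le_norm (A : Matrix (Fin K) (Fin K) ℝ) (i : Fin K) :
    ∑ j, |A i j| ≤ ‖A‖ := by
  have h1 := Finset.le_sup (f := fun i => ∑ j, ‖A i j‖₊) (Finset.mem_univ i)
  rw [← Matrix.linfty_opNNNorm_def] at h1
  have h2 := NNReal.coe_le_coe.2 h1
  push_cast at h2
  exact h2

theorem abs_entry_le_norm (A : Matrix (Fin K) (Fin K) ℝ) (i j : Fin K) : |A i j| ≤ ‖A‖ :=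
  (Finset.single_le_sum (f := fun j => |A i j|) (fun _ _ => abs_nonneg _) (Finset.mem_univ j)).trans
    (sum_abs_entry_le_norm A i)

end MatrixNorm

/-! ### Consequences of the moment condition. -/

section Moments

/-- The regularity of an admissible function beyond a threshold `x₁`. -/
structure IsRegularFrom (φ : ℝ≥0 → ℝ≥0) (x₁ : ℝ≥0) : Prop where
  pos : ∀ x, x₁ ≤ x → 0 < φ x
  mono : MonotoneOn φ (Set.Ici x₁)
  mono_div : MonotoneOn (fun x => x / φ x) (Set.Ici x₁)

theorem IsAdmissible.exists_isRegularFrom {φ : ℝ≥0 → ℝ≥0} (hφ : IsAdmissible φ) :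
    ∃ x₁, IsRegularFrom φ x₁ := by
  obtain ⟨a, ha⟩ := eventually_atTop.1 hφ.eventually_pos
  obtain ⟨b, hb⟩ := hφ.eventually_mono
  obtain ⟨c, hc⟩ := hφ.eventually_mono_div
  exact ⟨max a (max b c), fun x hx => ha x ((le_max_left _ _).trans hx),
    hb.mono (Set.Ici_subset_Ici.2 ((le_max_left _ _).trans (le_max_right _ _))),
    hc.mono (Set.Ici_subset_Ici.2 ((le_max_right _ _).trans (le_max_right _ _)))⟩

/-- If `φ < b` beyond `x₁`, the terms `1 / (n φ(n))` would dominate a multiple of the harmonic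
series. Unboundedness of `φ` is what yields uniform integrability. -/
theorem IsAdmissible.exists_le {φ : ℝ≥0 → ℝ≥0} (hφ : IsAdmissible φ) (x₁ : ℝ≥0) (b : ℝ) :
    ∃ x, x₁ ≤ x ∧ b ≤ φ x := by
  by_contra! h
  obtain ⟨a, ha⟩ := eventually_atTop.1 hφ.eventually_pos
  refine Real.not_summable_one_div_natCast ?_
  refine Summable.of_norm_bounded_eventually_nat (hφ.summable.mul_left b) ?_
  obtain ⟨N, hN⟩ := exists_nat_ge (max a x₁)
  filter_upwards [eventually_ge_atTop (max N 1)] with n hn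
  have hn1 : (0 : ℝ) < n := by exact_mod_cast (le_max_right N 1).trans hn
  have hNn : (max a x₁ : ℝ≥0) ≤ n :=
    hN.trans (by exact_mod_cast (le_max_left _ _).trans hn)
  have h1 : (0 : ℝ) < φ n := ha n ((le_max_left _ _).trans hNn)
  have h2 := h n ((le_max_right _ _).trans hNn)
  rw [Real.norm_of_nonneg (by positivity), mul_one_div, div_le_div_iff₀ hn1 (by positivity)]
  nlinarith

variable {Ω : Type*} {mΩ : MeasurableSpace Ω} {μ : Measure Ω}
  {φ : ℝ≥0 → ℝ≥0} {x₁ : ℝ≥0} {ρ : Ω → ℝ≥0} {M : ℝ≥0}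

theorem integrable_moment (hφm : Measurable φ) (hρ : Measurable ρ)
    (hM : ∫⁻ ω, ((ρ ω * φ (ρ ω) : ℝ≥0) : ℝ≥0∞) ∂μ ≤ M) :
    Integrable (fun ω => (ρ ω : ℝ) * φ (ρ ω)) μ ∧ ∫ ω, (ρ ω : ℝ) * φ (ρ ω) ∂μ ≤ M := by
  have hm : Measurable fun ω => ρ ω * φ (ρ ω) := hρ.mul (hφm.comp hρ)
  have e : ∀ ω, (ρ ω : ℝ) * φ (ρ ω) = ((ρ ω * φ (ρ ω) : ℝ≥0) : ℝ) := fun ω => by push_cast; rfl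
  simp only [e]
  constructor
  · refine ⟨hm.coe_nnreal_real.aestronglyMeasurable, ?_⟩
    rw [hasFiniteIntegral_iff_enorm]
    simp only [NNReal.enorm_eq]
    exact lt_of_le_of_lt hM ENNReal.coe_lt_top
  · rw [integral_eq_lintegral_of_nonneg_ae (ae_of_all _ fun ω => NNReal.coe_nonneg _)
      hm.coe_nnreal_real.aestronglyMeasurable]
    simp only [ENNReal.ofReal_coe_nnreal]
    exact ENNReal.toReal_le_coe_of_le_coe hM

variable [IsProbabilityMeasure μ]

theorem IsRegularFrom.integrable (hx : IsRegularFrom φ x₁) (hφm : Measurable φ)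
    (hρ : Measurable ρ) (hM : ∫⁻ ω, ((ρ ω * φ (ρ ω) : ℝ≥0) : ℝ≥0∞) ∂μ ≤ M) :
    Integrable (fun ω => (ρ ω : ℝ)) μ := by
  obtain ⟨hi, -⟩ := integrable_moment hφm hρ hM
  refine ((hi.div_const (φ x₁ : ℝ)).add (integrable_const (x₁ : ℝ))).mono'
    hρ.coe_nnreal_real.aestronglyMeasurable (ae_of_all _ fun ω => ?_)
  have h0 : (0 : ℝ) < φ x₁ := hx.pos x₁ le_rfl
  rw [Real.norm_of_nonneg (NNReal.coe_nonneg _), Pi.add_apply]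
  rcases le_total x₁ (ρ ω) with h | h
  · have h1 : (φ x₁ : ℝ) ≤ φ (ρ ω) := hx.mono Set.self_mem_Ici h h
    have h2 : (ρ ω : ℝ) ≤ ρ ω * φ (ρ ω) / φ x₁ := by
      rw [le_div_iff₀ h0]
      exact mul_le_mul_of_nonneg_left h1 (NNReal.coe_nonneg _)
    linarith [x₁.coe_nonneg]
  · have h1 : (ρ ω : ℝ) ≤ x₁ := h
    have : (0 : ℝ) ≤ ρ ω * φ (ρ ω) / φ x₁ := by positivity
    linarith

/-- A Markov-type bound: where `ρ ≥ t`, monotonicity of `φ` gives `ρ ≤ ρ φ(ρ) / φ(t)`. -/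
theorem IsRegularFrom.integral_indicator_le (hx : IsRegularFrom φ x₁) (hφm : Measurable φ)
    (hρ : Measurable ρ) (hM : ∫⁻ ω, ((ρ ω * φ (ρ ω) : ℝ≥0) : ℝ≥0∞) ∂μ ≤ M) {t : ℝ≥0}
    (ht : x₁ ≤ t) : ∫ ω, {ω | t ≤ ρ ω}.indicator (fun ω => (ρ ω : ℝ)) ω ∂μ ≤ M / φ t := by
  obtain ⟨hi, hle⟩ := integrable_moment hφm hρ hM
  have h0 : (0 : ℝ) < φ t := hx.pos t ht
  refine le_trans ?_ (div_le_div_of_nonneg_right hle h0.le)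
  rw [← integral_div]
  refine integral_mono ((hx.integrable hφm hρ hM).indicator (measurableSet_le measurable_const hρ))
    (hi.div_const _) fun ω => ?_
  refine Set.indicator_apply_le' (fun h : t ≤ ρ ω => ?_) fun _ => by positivity
  rw [le_div_iff₀ h0]
  exact mul_le_mul_of_nonneg_left (hx.mono ht (ht.trans h) h) (NNReal.coe_nonneg _)

/-- For `x₁ ≤ ρ ≤ t`, write `ρ² = ρ φ(ρ) · ρ / φ(ρ)` and use monotonicity of `x / φ(x)`. The term
`x₁²` covers small `ρ`, where nothing is known about `φ`. -/
theorem IsRegularFrom.integral_sq_indicator_le (hx : IsRegularFrom φ x₁) (hφm : Measurable φ)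
    (hρ : Measurable ρ) (hM : ∫⁻ ω, ((ρ ω * φ (ρ ω) : ℝ≥0) : ℝ≥0∞) ∂μ ≤ M) {t : ℝ≥0}
    (ht : x₁ ≤ t) : ∫ ω, {ω | t < ρ ω}ᶜ.indicator (fun ω => (ρ ω : ℝ) ^ 2) ω ∂μ ≤
      (x₁ : ℝ) ^ 2 + M * (t / φ t) := by
  obtain ⟨hi, hle⟩ := integrable_moment hφm hρ hM
  have h0 : (0 : ℝ) < φ t := hx.pos t ht
  refine le_trans ?_ (add_le_add_right (mul_le_mul_of_nonneg_right hle
    (by positivity : (0 : ℝ) ≤ t / φ t)) _)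
  rw [← integral_mul_const]
  have e : (x₁ : ℝ) ^ 2 = ∫ _, (x₁ : ℝ) ^ 2 ∂μ := by simp
  rw [e, ← integral_add (integrable_const _) (hi.mul_const _)]
  refine integral_mono_of_nonneg
    (ae_of_all _ fun ω => Set.indicator_nonneg (fun ω _ => sq_nonneg _) ω)
    ((integrable_const _).add (hi.mul_const _)) (ae_of_all _ fun ω => ?_)
  refine Set.indicator_apply_le' (fun h : ¬ t < ρ ω => ?_) fun _ => by positivity
  rcases le_total x₁ (ρ ω) with h1 | h1
  · have h2 : ((ρ ω / φ (ρ ω) : ℝ≥0) : ℝ) ≤ ((t / φ t : ℝ≥0) : ℝ) :=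
      hx.mono_div h1 ht (not_lt.1 h)
    push_cast at h2
    have h3 : (0 : ℝ) < φ (ρ ω) := hx.pos _ h1
    calc (ρ ω : ℝ) ^ 2 = ρ ω * φ (ρ ω) * (ρ ω / φ (ρ ω)) := by field_simp
      _ ≤ ρ ω * φ (ρ ω) * (t / φ t) := mul_le_mul_of_nonneg_left h2 (by positivity)
      _ ≤ _ := le_add_of_nonneg_left (sq_nonneg _)
  · have h2 : (ρ ω : ℝ) ≤ x₁ := h1
    calc (ρ ω : ℝ) ^ 2 ≤ (x₁ : ℝ) ^ 2 := by gcongr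
      _ ≤ _ := le_add_of_nonneg_right (by positivity)

theorem summable_inv_mul_shift (hφ : IsAdmissible φ) :
    Summable fun k : ℕ => 1 / (((k : ℝ) + 1) * φ (k + 1)) := by
  have := (summable_nat_add_iff 1).2 hφ.summable
  simpa using this

theorem summable_one_div_sq_shift : Summable fun k : ℕ => 1 / ((k : ℝ) + 1) ^ 2 := by
  have := (summable_nat_add_iff 1).2 (Real.summable_one_div_nat_pow.2 one_lt_two)
  simpa using this

theorem eventually_le_natCast_add_one (x : ℝ≥0) : ∀ᶠ k : ℕ in atTop, x ≤ (k : ℝ≥0) + 1 := by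
  obtain ⟨N, hN⟩ := exists_nat_ge x
  filter_upwards [eventually_ge_atTop N] with k hk
  exact hN.trans ((Nat.cast_le.2 hk).trans (le_add_of_nonneg_right zero_le_one))

variable {ρ : ℕ → Ω → ℝ≥0}

theorem IsAdmissible.summable_integral_indicator (hφ : IsAdmissible φ)
    (hρ : ∀ k, Measurable (ρ k))
    (hM : ∀ k, ∫⁻ ω, ((ρ k ω * φ (ρ k ω) : ℝ≥0) : ℝ≥0∞) ∂μ ≤ M) :
    Summable fun k : ℕ =>
      (∫ ω, {ω | (k : ℝ) + 1 < ρ k ω}.indicator (fun ω => (ρ k ω : ℝ)) ω ∂μ) / ((k : ℝ) + 1) := by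
  obtain ⟨x₁, hx⟩ := hφ.exists_isRegularFrom
  refine Summable.of_norm_bounded_eventually_nat ((summable_inv_mul_shift hφ).mul_left (M : ℝ)) ?_
  filter_upwards [eventually_le_natCast_add_one x₁] with k hk
  have hk0 : (0 : ℝ) < (k : ℝ) + 1 := by positivity
  have hi := hx.integrable hφ.measurable (hρ k) (hM k)
  rw [Real.norm_of_nonneg (div_nonneg (integral_nonneg fun ω =>
    Set.indicator_nonneg (fun ω _ => NNReal.coe_nonneg _) ω) hk0.le)]
  have h1 := hx.integral_indicator_le hφ.measurable (hρ k) (hM k) hk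
  have h2 : ∫ ω, {ω | (k : ℝ) + 1 < ρ k ω}.indicator (fun ω => (ρ k ω : ℝ)) ω ∂μ ≤
      ∫ ω, {ω | (k : ℝ≥0) + 1 ≤ ρ k ω}.indicator (fun ω => (ρ k ω : ℝ)) ω ∂μ := by
    refine integral_mono_of_nonneg
      (ae_of_all _ fun ω => Set.indicator_nonneg (fun ω _ => NNReal.coe_nonneg _) ω)
      (hi.indicator (measurableSet_le measurable_const (hρ k))) (ae_of_all _ fun ω => ?_)
    refine Set.indicator_le_indicator_of_subset (fun ω (h : (k : ℝ) + 1 < ρ k ω) => ?_)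
      (fun ω => NNReal.coe_nonneg _) ω
    have : ((k + 1 : ℝ≥0) : ℝ) ≤ ρ k ω := by push_cast; exact h.le
    exact this
  calc _ ≤ (M / φ (k + 1) : ℝ) / ((k : ℝ) + 1) :=
        div_le_div_of_nonneg_right (h2.trans h1) hk0.le
    _ = _ := by rw [div_div, mul_one_div, mul_comm]

/-- At `t = k + 1` the truncated second moment divided by `t²` is at most `x₁² / t² + M / (t φ(t))`,
and both terms are summable. -/
theorem IsAdmissible.summable_integral_sq_indicator (hφ : IsAdmissible φ)
    (hρ : ∀ k, Measurable (ρ k))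
    (hM : ∀ k, ∫⁻ ω, ((ρ k ω * φ (ρ k ω) : ℝ≥0) : ℝ≥0∞) ∂μ ≤ M) :
    Summable fun k : ℕ =>
      (∫ ω, {ω | (k : ℝ) + 1 < ρ k ω}ᶜ.indicator (fun ω => (ρ k ω : ℝ) ^ 2) ω ∂μ)
        / ((k : ℝ) + 1) ^ 2 := by
  obtain ⟨x₁, hx⟩ := hφ.exists_isRegularFrom
  refine Summable.of_norm_bounded_eventually_nat
    ((summable_one_div_sq_shift.mul_left ((x₁ : ℝ) ^ 2)).add
      ((summable_inv_mul_shift hφ).mul_left (M : ℝ))) ?_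
  filter_upwards [eventually_le_natCast_add_one x₁] with k hk
  have hk0 : (0 : ℝ) < (k : ℝ) + 1 := by positivity
  have h0 : (0 : ℝ) < φ (k + 1) := hx.pos _ hk
  rw [Real.norm_of_nonneg (div_nonneg (integral_nonneg fun ω =>
    Set.indicator_nonneg (fun ω _ => sq_nonneg _) ω) (by positivity))]
  have h1 := hx.integral_sq_indicator_le hφ.measurable (hρ k) (hM k) hk
  have hset : {ω | (k : ℝ) + 1 < ρ k ω} = {ω | (k : ℝ≥0) + 1 < ρ k ω} := by
    ext ω
    change (k : ℝ) + 1 < ρ k ω ↔ (k : ℝ≥0) + 1 < ρ k ω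
    rw [← NNReal.coe_lt_coe]
    push_cast
    rfl
  rw [hset]
  refine (div_le_div_of_nonneg_right h1 (by positivity)).trans (le_of_eq ?_)
  push_cast
  field_simp

theorem IsAdmissible.uniformIntegrable_of_abs_le (hφ : IsAdmissible φ)
    (hρ : ∀ k, Measurable (ρ k))
    (hM : ∀ k, ∫⁻ ω, ((ρ k ω * φ (ρ k ω) : ℝ≥0) : ℝ≥0∞) ∂μ ≤ M) {f : ℕ → Ω → ℝ}
    (hf : ∀ k, AEStronglyMeasurable (f k) μ) (hfρ : ∀ k, ∀ᵐ ω ∂μ, |f k ω| ≤ ρ k ω) :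
    UniformIntegrable f 1 μ := by
  obtain ⟨x₁, hx⟩ := hφ.exists_isRegularFrom
  refine uniformIntegrable_of le_rfl ENNReal.one_ne_top hf fun ε hε => ?_
  -- Then `M / φ(t) ≤ ε` bounds all tails above `t` at once, as in de la Vallée-Poussin's criterion.
  obtain ⟨t, ht, hle⟩ := hφ.exists_le x₁ (M / ε)
  refine ⟨t, fun k => ?_⟩
  have h0 : (0 : ℝ) < φ t := hx.pos t ht
  have h1 := hx.integral_indicator_le hφ.measurable (hρ k) (hM k) ht
  have hi := (hx.integrable hφ.measurable (hρ k) (hM k)).indicator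
    (measurableSet_le measurable_const (hρ k) : MeasurableSet {ω | t ≤ ρ k ω})
  calc eLpNorm ({ω | t ≤ ‖f k ω‖₊}.indicator (f k)) 1 μ
      ≤ eLpNorm ({ω | t ≤ ρ k ω}.indicator fun ω => (ρ k ω : ℝ)) 1 μ := by
        refine eLpNorm_mono_ae ?_
        filter_upwards [hfρ k] with ω hω
        rw [norm_indicator_eq_indicator_norm, norm_indicator_eq_indicator_norm]
        by_cases h : t ≤ ‖f k ω‖₊
        · have h2 : ‖f k ω‖₊ ≤ ρ k ω := hω
          rw [Set.indicator_of_mem (show ω ∈ {ω | t ≤ ‖f k ω‖₊} from h),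
            Set.indicator_of_mem (show ω ∈ {ω | t ≤ ρ k ω} from h.trans h2)]
          simpa using hω
        · rw [Set.indicator_of_notMem (show ω ∉ {ω | t ≤ ‖f k ω‖₊} from h)]
          exact Set.indicator_nonneg (fun ω _ => norm_nonneg _) ω
    _ = ENNReal.ofReal (∫ ω, {ω | t ≤ ρ k ω}.indicator (fun ω => (ρ k ω : ℝ)) ω ∂μ) := by
        rw [eLpNorm_one_eq_lintegral_enorm, ← ofReal_integral_norm_eq_lintegral_enorm hi]
        congr 1
        exact integral_congr_ae (ae_of_all _ fun ω => Real.norm_of_nonneg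
          (Set.indicator_nonneg (fun ω _ => NNReal.coe_nonneg _) ω))
    _ ≤ ENNReal.ofReal ε := by
        refine ENNReal.ofReal_le_ofReal (h1.trans ?_)
        rw [div_le_iff₀ hε] at hle
        rw [div_le_iff₀ h0, mul_comm]
        exact hle

end Moments

/-! ### Factorization under conditional independence. -/

section CondIndep

variable {Ω α : Type*} {mΩ : MeasurableSpace Ω} {μ : Measure Ω} [IsProbabilityMeasure μ]
  [mα : MeasurableSpace α]

/-- If the event `E` and `X` are conditionally independent given `m`, the conditional expectation
of `f(X)` on `E` factorizes, for every integrable `f(X)`. -/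
theorem condExp_indicator_comp {m : MeasurableSpace Ω} (hm : m ≤ mΩ) {E : Set Ω}
    (hE : MeasurableSet[mΩ] E) {X : Ω → α} (hX : Measurable[mΩ] X) {f : α → ℝ} (hf : Measurable f)
    (hfi : Integrable (fun ω => f (X ω)) μ)
    (hci : ∀ t, MeasurableSet t →
      μ⟦E ∩ X ⁻¹' t | m⟧ =ᵐ[μ] fun ω => (μ⟦E | m⟧) ω * (μ⟦X ⁻¹' t | m⟧) ω) :
    μ[E.indicator (fun ω => f (X ω)) | m] =ᵐ[μ]
      fun ω => (μ⟦E | m⟧) ω * (μ[fun ω => f (X ω) | m]) ω := by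
  set g : Ω → ℝ := μ⟦E | m⟧ with hg
  have hgm : StronglyMeasurable[m] g := stronglyMeasurable_condExp
  have hgm' : AEStronglyMeasurable[mΩ] g μ := (hgm.mono hm).aestronglyMeasurable
  have hgb : ∀ᵐ ω ∂μ, |g ω| ≤ 1 := by
    refine ae_bdd_abs_condExp_of_ae_bdd_abs (ae_of_all _ fun ω => ?_)
    by_cases h : ω ∈ E <;> simp [h]
  have hgi : ∀ {F : Ω → ℝ}, Integrable F μ → Integrable (fun ω => g ω * F ω) μ := fun hF =>
    hF.bdd_mul hgm' hgb
  have hpull : ∀ {F : Ω → ℝ}, Integrable F μ →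
      μ[fun ω => g ω * F ω | m] =ᵐ[μ] fun ω => g ω * μ[F | m] ω := fun hF =>
    condExp_stronglyMeasurable_mul_of_bound hm hgm hF 1 hgb
  have hind : ∀ {s : Set Ω}, MeasurableSet[mΩ] s → Integrable (s.indicator fun _ => (1 : ℝ)) μ :=
    fun hs => (integrable_const 1).indicator hs
  have hmain : ∀ B, MeasurableSet[m] B →
      ∫ ω in B, E.indicator (fun ω => f (X ω)) ω ∂μ = ∫ ω in B, g ω * f (X ω) ∂μ := by
    intro B hB
    have hB' := hm B hB
    -- The hypothesis says that `q` integrates to zero over every event of `σ(X)`, that is, `E(q |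
    -- X) = 0`. Pulling `f(X)` out of this conditional expectation handles every integrable `f(X)`
    -- without approximation by simple functions.
    set q : Ω → ℝ := B.indicator fun ω => E.indicator (fun _ => (1 : ℝ)) ω - g ω with hq
    have hqi : Integrable q μ := ((hind hE).sub integrable_condExp).indicator hB'
    set mX : MeasurableSpace Ω := mα.comap X with hmX
    have hmX' : mX ≤ mΩ := hX.comap_le
    have hq0 : (0 : Ω → ℝ) =ᵐ[μ] μ[q | mX] := by
      refine ae_eq_condExp_of_forall_setIntegral_eq hmX' hqi
        (fun s _ _ => (integrable_zero _ _ _).integrableOn) ?_ aestronglyMeasurable_zero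
      rintro _ ⟨t, ht, rfl⟩ -
      have hs : MeasurableSet[mΩ] (X ⁻¹' t) := hX ht
      have e1 : ∫ ω in X ⁻¹' t, q ω ∂μ = ∫ ω in B, ((E ∩ X ⁻¹' t).indicator (fun _ => (1 : ℝ)) ω
          - g ω * (X ⁻¹' t).indicator (fun _ => (1 : ℝ)) ω) ∂μ := by
        rw [← integral_indicator hs, ← integral_indicator hB']
        congr 1
        ext ω
        by_cases h1 : ω ∈ X ⁻¹' t <;> by_cases h2 : ω ∈ B <;> by_cases h3 : ω ∈ E <;>
          simp [hq, h1, h2, h3]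
      have e2 : ∫ ω in B, (E ∩ X ⁻¹' t).indicator (fun _ => (1 : ℝ)) ω ∂μ =
          ∫ ω in B, g ω * (X ⁻¹' t).indicator (fun _ => (1 : ℝ)) ω ∂μ := by
        rw [← setIntegral_condExp hm (hind (hE.inter hs)) hB,
          ← setIntegral_condExp hm (hgi (hind hs)) hB]
        exact setIntegral_congr_ae hB' (((hci t ht).trans (hpull (hind hs)).symm).mono
          fun ω h _ => h)
      rw [e1, integral_sub (hind (hE.inter hs)).integrableOn (hgi (hind hs)).integrableOn, e2,
        sub_self]
      simp
    have hfm : StronglyMeasurable[mX] fun ω => f (X ω) :=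
      (hf.comp (comap_measurable X)).stronglyMeasurable
    have hfq : Integrable ((fun ω => f (X ω)) * q) μ := by
      have : (fun ω => f (X ω)) * q =
          B.indicator fun ω => E.indicator (fun ω => f (X ω)) ω - g ω * f (X ω) := by
        ext ω
        by_cases h2 : ω ∈ B <;> by_cases h3 : ω ∈ E <;> simp [hq, h2, h3] <;> ring
      rw [this]
      exact ((hfi.indicator hE).sub (hgi hfi)).indicator hB'
    have h1 : ∫ ω, ((fun ω => f (X ω)) * q) ω ∂μ = 0 := by
      rw [← integral_condExp hmX']
      refine integral_eq_zero_of_ae ?_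
      filter_upwards [condExp_mul_of_stronglyMeasurable_left hfm hfq hqi, hq0] with ω h2 h3
      rw [h2, Pi.mul_apply, ← h3, Pi.zero_apply, mul_zero]
    rw [← sub_eq_zero, ← integral_sub (hfi.indicator hE).integrableOn (hgi hfi).integrableOn,
      ← integral_indicator hB', ← h1]
    congr 1
    ext ω
    by_cases h2 : ω ∈ B <;> by_cases h3 : ω ∈ E <;> simp [hq, h2, h3] <;> ring
  refine (ae_eq_condExp_of_forall_setIntegral_eq hm (hfi.indicator hE)
    (fun s _ _ => integrable_condExp.integrableOn) (fun B hB _ => ?_)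
    stronglyMeasurable_condExp.aestronglyMeasurable).symm.trans (hpull hfi)
  rw [setIntegral_condExp hm (hgi hfi) hB, hmain B hB]

end CondIndep
-- The urn as a sum of adapted increments.
section Model

variable {Ω : Type*} {mΩ : MeasurableSpace Ω} {μ : Measure Ω} {K : ℕ}
  {C₀ : Ω → Fin K → ℝ} {χ : ℕ → Ω → Fin K → ℝ} {R : ℕ → Ω → Matrix (Fin K) (Fin K) ℝ}
  {H : Ω → Matrix (Fin K) (Fin K) ℝ} {φ : ℝ≥0 → ℝ≥0}

theorem history_mono : Monotone (history C₀ χ R) := fun _ _ hmn =>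
  sup_le_sup_left (biSup_mono fun _ hk => Finset.Icc_subset_Icc_right hmn hk) _

theorem IsUrnModel.history_le (hurn : IsUrnModel μ C₀ χ R) (n : ℕ) : history C₀ χ R n ≤ mΩ :=
  sup_le hurn.measurable_init.comap_le <| iSup₂_le fun m hm =>
    sup_le (hurn.measurable_replacement m (Finset.mem_Icc.1 hm).1).comap_le
      (hurn.measurable_choice m (Finset.mem_Icc.1 hm).1).comap_le

/-- The filtration of the histories of an urn. -/
def IsUrnModel.filtration (hurn : IsUrnModel μ C₀ χ R) : Filtration ℕ mΩ where
  seq := history C₀ χ R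
  mono' := history_mono
  le' := hurn.history_le

theorem comap_step_le_history {m n : ℕ} (hm : 1 ≤ m) (hmn : m ≤ n) :
    MeasurableSpace.comap (R m) inferInstance ⊔ MeasurableSpace.comap (χ m) inferInstance
      ≤ history C₀ χ R n :=
  le_sup_of_le_right <| le_iSup₂_of_le m (Finset.mem_Icc.2 ⟨hm, hmn⟩) le_rfl

theorem measurable_replacement_history {m n : ℕ} (hm : 1 ≤ m) (hmn : m ≤ n) :
    Measurable[history C₀ χ R n] (R m) :=
  measurable_iff_comap_le.2 (le_sup_left.trans (comap_step_le_history hm hmn))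

theorem measurable_choice_history {m n : ℕ} (hm : 1 ≤ m) (hmn : m ≤ n) :
    Measurable[history C₀ χ R n] (χ m) :=
  measurable_iff_comap_le.2 (le_sup_right.trans (comap_step_le_history hm hmn))

theorem measurable_composition (hurn : IsUrnModel μ C₀ χ R) (n : ℕ) :
    Measurable (composition C₀ χ R n) := by
  induction n with
  | zero => exact hurn.measurable_init
  | succ n ih =>
    refine measurable_pi_iff.2 fun j => ?_
    have h1 := hurn.measurable_choice (n + 1) n.succ_pos
    have h2 := hurn.measurable_replacement (n + 1) n.succ_pos
    simp only [composition, Pi.add_apply, Matrix.vecMul, dotProduct]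
    exact ((measurable_pi_apply j).comp ih).add (Finset.measurable_fun_sum _ fun i _ =>
      ((measurable_pi_apply i).comp h1).mul ((measurable_matrix_entry i j).comp h2))

theorem measurable_total (hurn : IsUrnModel μ C₀ χ R) (n : ℕ) : Measurable (total C₀ χ R n) :=
  Finset.measurable_fun_sum _ fun i _ => (measurable_pi_apply i).comp (measurable_composition hurn n)

/-- The event that color `i` is chosen in trial `k + 1`. -/
def choiceEvent (χ : ℕ → Ω → Fin K → ℝ) (k : ℕ) (i : Fin K) : Set Ω :=
  χ (k + 1) ⁻¹' {Pi.single i 1}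

theorem measurableSet_choiceEvent (k : ℕ) (i : Fin K) :
    MeasurableSet[history C₀ χ R (k + 1)] (choiceEvent χ k i) :=
  measurable_choice_history k.succ_pos le_rfl (measurableSet_singleton _)

theorem indicator_choiceEvent {k : ℕ} {ω : Ω} (h : ∃ i, χ (k + 1) ω = Pi.single i 1) (i : Fin K)
    (f : Ω → ℝ) : (choiceEvent χ k i).indicator f ω = χ (k + 1) ω i * f ω := by
  obtain ⟨i₀, h⟩ := h
  by_cases hi : i = i₀
  · subst hi
    rw [Set.indicator_of_mem (show ω ∈ choiceEvent χ k i from h), h, Pi.single_eq_same, one_mul]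
  · have : ω ∉ choiceEvent χ k i := fun h' => by
      have h2 : χ (k + 1) ω = Pi.single i 1 := h'
      rw [h] at h2
      have h3 := congrFun h2 i
      rw [Pi.single_eq_same, Pi.single_eq_of_ne hi] at h3
      exact zero_ne_one h3
    rw [Set.indicator_of_notMem this, h, Pi.single_eq_of_ne hi, zero_mul]

theorem IsUrnModel.ae_choice_basis (hurn : IsUrnModel μ C₀ χ R) :
    ∀ᵐ ω ∂μ, ∀ k, ∃ i, χ (k + 1) ω = Pi.single i 1 :=
  ae_all_iff.2 fun k => hurn.choice_basis (k + 1) k.succ_pos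

/-- Indicators of the choice events replace the coordinates of `χ`, the form in which both
conditional independence and the strong law apply. -/
theorem composition_eq_sum {ω : Ω} (h : ∀ k, ∃ i, χ (k + 1) ω = Pi.single i 1) (n : ℕ)
    (j : Fin K) : composition C₀ χ R n ω j = C₀ ω j + ∑ k ∈ Finset.range n, ∑ i,
      (choiceEvent χ k i).indicator (fun ω => R (k + 1) ω i j) ω := by
  induction n with
  | zero => simp [composition]
  | succ n ih =>
    rw [Finset.sum_range_succ, ← add_assoc, ← ih]
    simp only [composition, Pi.add_apply, Matrix.vecMul, dotProduct]
    exact congrArg _ (Finset.sum_congr rfl fun i _ => (indicator_choiceEvent (h n) i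
      fun ω => R (n + 1) ω i j).symm)

theorem count_eq_sum {ω : Ω} (h : ∀ k, ∃ i, χ (k + 1) ω = Pi.single i 1) (n : ℕ)
    (i : Fin K) : count χ n ω i = ∑ k ∈ Finset.range n,
      (choiceEvent χ k i).indicator (fun _ => (1 : ℝ)) ω := by
  induction n with
  | zero => simp [count]
  | succ n ih =>
    rw [Finset.sum_range_succ, ← ih, indicator_choiceEvent (h n), mul_one]
    simp only [count]
    rw [Finset.sum_Icc_succ_top (by lia), Pi.add_apply]

theorem total_eq_sum {ω : Ω} (h : ∀ k, ∃ i, χ (k + 1) ω = Pi.single i 1) (n : ℕ) :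
    total C₀ χ R n ω = ∑ j, C₀ ω j + ∑ k ∈ Finset.range n, ∑ j, ∑ i,
      (choiceEvent χ k i).indicator (fun ω => R (k + 1) ω i j) ω := by
  simp only [total, composition_eq_sum h, Finset.sum_add_distrib]
  rw [Finset.sum_comm]

theorem sum_indicator_replacement_eq {k : ℕ} {ω : Ω} {i₀ : Fin K}
    (h : χ (k + 1) ω = Pi.single i₀ 1) (j : Fin K) :
    ∑ i, (choiceEvent χ k i).indicator (fun ω => R (k + 1) ω i j) ω = R (k + 1) ω i₀ j := by
  simp only [indicator_choiceEvent ⟨i₀, h⟩, h, Pi.single_apply, ite_mul, one_mul, zero_mul]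
  simp

/-- The contents of the urn are nonnegative and not all zero. -/
theorem IsUrnModel.ae_nonneg_pos (hurn : IsUrnModel μ C₀ χ R) :
    ∀ᵐ ω ∂μ, ∀ n, (∀ i, 0 ≤ composition C₀ χ R n ω i) ∧ 0 < total C₀ χ R n ω := by
  filter_upwards [hurn.ae_choice_basis, hurn.init_nonneg, hurn.init_ne_zero,
    ae_all_iff.2 fun k : ℕ => hurn.replacement_nonneg (k + 1) k.succ_pos] with ω hb h0 hne hR n
  have hterm : ∀ k j, 0 ≤ ∑ i, (choiceEvent χ k i).indicator (fun ω => R (k + 1) ω i j) ω :=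
    fun k j => by
      obtain ⟨i₀, h⟩ := hb k
      rw [sum_indicator_replacement_eq h]
      exact hR k i₀ j
  refine ⟨fun i => ?_, ?_⟩
  · rw [composition_eq_sum hb]
    exact add_nonneg (h0 i) (Finset.sum_nonneg fun k _ => hterm k i)
  · rw [total_eq_sum hb]
    obtain ⟨i, hi⟩ := Function.ne_iff.1 hne
    exact add_pos_of_pos_of_nonneg (Finset.sum_pos' (fun i _ => h0 i)
      ⟨i, Finset.mem_univ i, lt_of_le_of_ne (h0 i) (Ne.symm hi)⟩)
      (Finset.sum_nonneg fun k _ => Finset.sum_nonneg fun j _ => hterm k j)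

theorem BoundedMoment.exists_bound (hmoment : BoundedMoment μ φ R) : ∃ M : ℝ≥0, ∀ k,
    ∫⁻ ω, ((‖R (k + 1) ω‖₊ * φ ‖R (k + 1) ω‖₊ : ℝ≥0) : ℝ≥0∞) ∂μ ≤ M := by
  refine ⟨(⨆ n : ℕ, ∫⁻ ω, ((‖R (n + 1) ω‖₊ * φ ‖R (n + 1) ω‖₊ : ℝ≥0) : ℝ≥0∞) ∂μ).toNNReal,
    fun k => ?_⟩
  rw [ENNReal.coe_toNNReal hmoment.ne]
  exact le_iSup (fun n : ℕ => ∫⁻ ω, ((‖R (n + 1) ω‖₊ * φ ‖R (n + 1) ω‖₊ : ℝ≥0) : ℝ≥0∞) ∂μ) k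

variable [IsProbabilityMeasure μ]

theorem IsUrnModel.integrable_norm (hurn : IsUrnModel μ C₀ χ R) (hφ : IsAdmissible φ)
    (hmoment : BoundedMoment μ φ R) (k : ℕ) :
    Integrable (fun ω => ((‖R (k + 1) ω‖₊ : ℝ≥0) : ℝ)) μ := by
  obtain ⟨x₁, hx⟩ := hφ.exists_isRegularFrom
  obtain ⟨M, hM⟩ := hmoment.exists_bound
  exact hx.integrable hφ.measurable
    (measurable_matrix_nnnorm.comp (hurn.measurable_replacement (k + 1) k.succ_pos)) (hM k)

theorem IsUrnModel.integrable_entry (hurn : IsUrnModel μ C₀ χ R) (hφ : IsAdmissible φ)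
    (hmoment : BoundedMoment μ φ R) (k : ℕ) (i j : Fin K) :
    Integrable (fun ω => R (k + 1) ω i j) μ :=
  (hurn.integrable_norm hφ hmoment k).mono'
    ((measurable_matrix_entry i j).comp
      (hurn.measurable_replacement (k + 1) k.succ_pos)).aestronglyMeasurable
    (ae_of_all _ fun _ => abs_entry_le_norm _ i j)

theorem IsUrnModel.condExp_indicator_replacement (hurn : IsUrnModel μ C₀ χ R)
    (hφ : IsAdmissible φ) (hmoment : BoundedMoment μ φ R) (k : ℕ) (i j : Fin K) :
    μ[(choiceEvent χ k i).indicator (fun ω => R (k + 1) ω i j) | history C₀ χ R k] =ᵐ[μ]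
      fun ω => composition C₀ χ R k ω i / total C₀ χ R k ω * generating μ C₀ χ R k ω i j := by
  have h1 := condExp_indicator_comp (hurn.history_le k)
    (hurn.history_le _ _ (measurableSet_choiceEvent k i))
    (hurn.measurable_replacement (k + 1) k.succ_pos) (measurable_matrix_entry i j)
    (hurn.integrable_entry hφ hmoment k i j)
    (fun t ht => hurn.condIndep k {Pi.single i 1} t (measurableSet_singleton _) ht)
  filter_upwards [h1, hurn.choice_prob k i] with ω h2 h3
  rw [h2]
  exact congrArg (· * _) h3

theorem IsUrnModel.ae_tendsto_replacement (hurn : IsUrnModel μ C₀ χ R)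
    (hφ : IsAdmissible φ) (hmoment : BoundedMoment μ φ R) (i j : Fin K) :
    ∀ᵐ ω ∂μ, Tendsto (fun n : ℕ => (n : ℝ)⁻¹ * ∑ k ∈ Finset.range n,
      ((choiceEvent χ k i).indicator (fun ω => R (k + 1) ω i j) ω -
        composition C₀ χ R k ω i / total C₀ χ R k ω * generating μ C₀ χ R k ω i j))
      atTop (𝓝 0) := by
  obtain ⟨M, hM⟩ := hmoment.exists_bound
  have hm : ∀ k, Measurable fun ω => ‖R (k + 1) ω‖₊ := fun k =>
    measurable_matrix_nnnorm.comp (hurn.measurable_replacement (k + 1) k.succ_pos)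
  have h1 := ae_tendsto_average_sub_condExp hurn.filtration
    (Z := fun k => (choiceEvent χ k i).indicator (fun ω => R (k + 1) ω i j))
    (ρ := fun k ω => ((‖R (k + 1) ω‖₊ : ℝ≥0) : ℝ))
    (fun k => Measurable.indicator ((measurable_matrix_entry i j).comp
      (measurable_replacement_history k.succ_pos le_rfl)) (measurableSet_choiceEvent k i))
    (fun k => (measurable_matrix_nnnorm.comp
      (measurable_replacement_history k.succ_pos le_rfl)).coe_nnreal_real)
    (hurn.integrable_norm hφ hmoment)
    (fun k => ae_of_all _ fun ω => by
      by_cases h : ω ∈ choiceEvent χ k i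
      · rw [Set.indicator_of_mem h]
        exact abs_entry_le_norm _ i j
      · rw [Set.indicator_of_notMem h, abs_zero]
        exact NNReal.coe_nonneg _)
    (hφ.summable_integral_indicator hm hM) (hφ.summable_integral_sq_indicator hm hM)
  filter_upwards [h1, ae_all_iff.2 fun k =>
    hurn.condExp_indicator_replacement hφ hmoment k i j] with ω h2 h3
  refine h2.congr fun n => congrArg _ (Finset.sum_congr rfl fun k _ => ?_)
  rw [← h3 k]
  rfl

theorem IsUrnModel.ae_tendsto_choice (hurn : IsUrnModel μ C₀ χ R) (i : Fin K) :
    ∀ᵐ ω ∂μ, Tendsto (fun n : ℕ => (n : ℝ)⁻¹ * ∑ k ∈ Finset.range n,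
      ((choiceEvent χ k i).indicator (fun _ => (1 : ℝ)) ω -
        composition C₀ χ R k ω i / total C₀ χ R k ω)) atTop (𝓝 0) := by
  -- With the constant dominating variable 1, truncation at `k + 1` never takes effect.
  have hempty : ∀ k : ℕ, {_ω : Ω | (k : ℝ) + 1 < 1} = ∅ := fun k => by
    have : ¬ ((k : ℝ) + 1 < 1) := by
      have : (0 : ℝ) ≤ k := k.cast_nonneg
      linarith
    simp [this]
  have h1 := ae_tendsto_average_sub_condExp (μ := μ) hurn.filtration
    (Z := fun k => (choiceEvent χ k i).indicator (fun _ => (1 : ℝ)))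
    (ρ := fun _ _ => 1)
    (fun k => Measurable.indicator measurable_const (measurableSet_choiceEvent k i))
    (fun k => measurable_const) (fun k => integrable_const 1)
    (fun k => ae_of_all _ fun ω => by
      by_cases h : ω ∈ choiceEvent χ k i <;> simp [h])
    (by simp only [hempty]; simp)
    (by simp only [hempty]; simpa using summable_one_div_sq_shift)
  filter_upwards [h1, ae_all_iff.2 fun k => hurn.choice_prob k i] with ω h2 h3
  refine h2.congr fun n => congrArg _ (Finset.sum_congr rfl fun k _ => ?_)
  rw [← h3 k]
  rfl

end Model
-- From the averages to all normalized sequences.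
section Pathwise

variable {n : Type*} [Fintype n]

/-- The convergence of all normalized sequences, from that of the averages of `X_k = C_k / S_k`. -/
theorem tendsto_normalized {A : Matrix n n ℝ} {lam : ℝ} {v : n → ℝ} {C N U : ℕ → n → ℝ}
    (hlam : lam ≠ 0) (hv : v ᵥ* A = lam • v) (hv1 : ∑ i, v i = 1)
    (hU : ∀ i, Tendsto (fun m : ℕ => (m : ℝ)⁻¹ * U m i) atTop (𝓝 (v i)))
    (hC : ∀ j, Tendsto (fun m : ℕ => (m : ℝ)⁻¹ * (C m j - (U m ᵥ* A) j)) atTop (𝓝 0))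
    (hN : ∀ i, Tendsto (fun m : ℕ => (m : ℝ)⁻¹ * (N m i - U m i)) atTop (𝓝 0)) :
    Tendsto (fun m => (∑ i, C m i)⁻¹ • C m) atTop (𝓝 v) ∧
      Tendsto (fun m : ℕ => (∑ i, C m i) / (m : ℝ)) atTop (𝓝 lam) ∧
      Tendsto (fun m : ℕ => (m : ℝ)⁻¹ • C m) atTop (𝓝 (lam • v)) ∧
      Tendsto (fun m : ℕ => (m : ℝ)⁻¹ • N m) atTop (𝓝 v) := by
  have h1 : ∀ j, Tendsto (fun m : ℕ => (m : ℝ)⁻¹ * C m j) atTop (𝓝 (lam * v j)) := fun j => by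
    have h2 : Tendsto (fun m : ℕ => ∑ i, (m : ℝ)⁻¹ * U m i * A i j) atTop (𝓝 ((v ᵥ* A) j)) :=
      tendsto_finsetSum _ fun i _ => (hU i).mul_const (A i j)
    rw [hv] at h2
    refine (((hC j).add h2).congr fun m => ?_).trans (by simp)
    simp only [Matrix.vecMul, dotProduct, mul_sub, Finset.mul_sum, mul_assoc]
    ring
  have h2 : Tendsto (fun m : ℕ => (∑ i, C m i) / (m : ℝ)) atTop (𝓝 lam) := by
    have h3 := tendsto_finsetSum Finset.univ fun j _ => h1 j
    rw [← Finset.mul_sum, hv1, mul_one] at h3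
    refine h3.congr fun m => ?_
    rw [← Finset.mul_sum, div_eq_inv_mul]
  refine ⟨tendsto_pi_nhds.2 fun i => ?_, h2, tendsto_pi_nhds.2 h1, tendsto_pi_nhds.2 fun i => ?_⟩
  · have h3 := (h2.inv₀ hlam).mul (h1 i)
    rw [inv_mul_cancel_left₀ hlam] at h3
    refine h3.congr' ?_
    filter_upwards [eventually_ge_atTop 1] with m hm
    have : (m : ℝ) ≠ 0 := by positivity
    rw [inv_div, Pi.smul_apply, smul_eq_mul, div_eq_mul_inv, mul_comm (m : ℝ), mul_assoc,
      mul_inv_cancel_left₀ this]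
  · refine (((hN i).add (hU i)).congr fun m => ?_).trans (by simp)
    rw [Pi.smul_apply, smul_eq_mul]
    ring

end Pathwise

/-! ### Almost sure convergence. -/

section AlmostSure

variable {Ω : Type*} [mΩ : MeasurableSpace Ω] {μ : Measure Ω} [IsProbabilityMeasure μ] {K : ℕ}
  {C₀ : Ω → Fin K → ℝ} {χ : ℕ → Ω → Fin K → ℝ} {R : ℕ → Ω → Matrix (Fin K) (Fin K) ℝ}
  {H : Ω → Matrix (Fin K) (Fin K) ℝ} {φ : ℝ≥0 → ℝ≥0}

/-- The composition vector is asymptotically the image under `H` of the sum of the previous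
proportions. -/
theorem IsUrnModel.ae_tendsto_composition_sub (hurn : IsUrnModel μ C₀ χ R)
    (hφ : IsAdmissible φ) (hmoment : BoundedMoment μ φ R) (hH : GeneratingCesaro μ C₀ χ R H) :
    ∀ᵐ ω ∂μ, ∀ j, Tendsto (fun m : ℕ => (m : ℝ)⁻¹ * (composition C₀ χ R m ω j -
      ((∑ k ∈ Finset.range m, (total C₀ χ R k ω)⁻¹ • composition C₀ χ R k ω) ᵥ* H ω) j))
      atTop (𝓝 0) := by
  filter_upwards [hurn.ae_choice_basis, hurn.ae_nonneg_pos, hH.cesaro,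
    ae_all_iff.2 fun i => ae_all_iff.2 fun j => hurn.ae_tendsto_replacement hφ hmoment i j]
    with ω hb hpos hces hZ j
  set X : ℕ → Fin K → ℝ := fun k i => composition C₀ χ R k ω i / total C₀ χ R k ω with hX
  have hX01 : ∀ k i, |X k i| ≤ 1 := fun k i => by
    rw [abs_of_nonneg (div_nonneg ((hpos k).1 i) (hpos k).2.le), div_le_one (hpos k).2]
    exact Finset.single_le_sum (fun i _ => (hpos k).1 i) (Finset.mem_univ i)
  have h1 : Tendsto (fun m : ℕ => (m : ℝ)⁻¹ * C₀ ω j) atTop (𝓝 0) := by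
    simpa using tendsto_inv_atTop_nhds_zero_nat.mul_const (C₀ ω j)
  have h2 := tendsto_finsetSum Finset.univ fun i _ => hZ i j
  -- The proportions lie in `[0, 1]`, so replacing `H_k` by `H` costs at most the Cesàro average of
  -- `‖H_k - H‖`.
  have h3 : ∀ i, Tendsto (fun m : ℕ => (m : ℝ)⁻¹ * ∑ k ∈ Finset.range m,
      X k i * (generating μ C₀ χ R k ω i j - H ω i j)) atTop (𝓝 0) := fun i => by
    refine squeeze_zero_norm (fun m => ?_) hces
    rw [Real.norm_eq_abs, abs_mul, abs_of_nonneg (by positivity), one_div]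
    refine mul_le_mul_of_nonneg_left ((Finset.abs_sum_le_sum_abs _ _).trans
      (Finset.sum_le_sum fun k _ => ?_)) (by positivity)
    rw [abs_mul]
    exact (mul_le_of_le_one_left (abs_nonneg _) (hX01 k i)).trans
      (abs_entry_le_norm (generating μ C₀ χ R k ω - H ω) i j)
  have h4 := (h1.add h2).add (tendsto_finsetSum Finset.univ fun i _ => h3 i)
  simp only [Finset.sum_const_zero, add_zero] at h4
  refine h4.congr fun m => ?_
  rw [composition_eq_sum hb, ← Finset.mul_sum, ← Finset.mul_sum, ← mul_add, ← mul_add]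
  congr 1
  simp only [Matrix.vecMul, dotProduct, Finset.sum_apply, Pi.smul_apply, smul_eq_mul]
  rw [add_assoc, ← Finset.sum_add_distrib, add_sub_assoc]
  congr 1
  rw [Finset.sum_comm (s := Finset.range m), ← Finset.sum_sub_distrib]
  refine Finset.sum_congr rfl fun i _ => ?_
  rw [Finset.sum_mul, ← Finset.sum_sub_distrib, ← Finset.sum_add_distrib]
  refine Finset.sum_congr rfl fun k _ => ?_
  simp only [hX]
  ring

theorem IsUrnModel.ae_tendsto_count_sub (hurn : IsUrnModel μ C₀ χ R) :
    ∀ᵐ ω ∂μ, ∀ i, Tendsto (fun m : ℕ => (m : ℝ)⁻¹ * (count χ m ω i -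
      (∑ k ∈ Finset.range m, (total C₀ χ R k ω)⁻¹ • composition C₀ χ R k ω) i))
      atTop (𝓝 0) := by
  filter_upwards [hurn.ae_choice_basis, ae_all_iff.2 fun i => hurn.ae_tendsto_choice i]
    with ω hb hZ i
  refine (hZ i).congr fun m => ?_
  rw [count_eq_sum hb, Finset.sum_apply, ← Finset.sum_sub_distrib]
  simp only [Pi.smul_apply, smul_eq_mul, div_eq_inv_mul]

theorem IsUrnModel.nonempty (hurn : IsUrnModel μ C₀ χ R) : Nonempty (Fin K) := by
  obtain ⟨ω, hω⟩ := hurn.init_ne_zero.exists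
  obtain ⟨i, -⟩ := Function.ne_iff.1 hω
  exact ⟨i⟩

/-- The almost sure part of the limit theorem. -/
theorem IsUrnModel.exists_ae_tendsto (hurn : IsUrnModel μ C₀ χ R)
    (hφ : IsAdmissible φ) (hmoment : BoundedMoment μ φ R) (hH : GeneratingCesaro μ C₀ χ R H) :
    ∃ (lam : Ω → ℝ) (piv : Ω → Fin K → ℝ), ∀ᵐ ω ∂μ,
      (IsDominantEigenvalue (H ω) (lam ω) ∧ IsPerronVector (H ω) (lam ω) (piv ω) ∧
        ∀ v, IsPerronVector (H ω) (lam ω) v → v = piv ω) ∧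
      Tendsto (fun m => (total C₀ χ R m ω)⁻¹ • composition C₀ χ R m ω) atTop (𝓝 (piv ω)) ∧
      Tendsto (fun m : ℕ => total C₀ χ R m ω / (m : ℝ)) atTop (𝓝 (lam ω)) ∧
      Tendsto (fun m : ℕ => (m : ℝ)⁻¹ • composition C₀ χ R m ω) atTop (𝓝 (lam ω • piv ω)) ∧
      Tendsto (fun m : ℕ => (m : ℝ)⁻¹ • count χ m ω) atTop (𝓝 (piv ω)) := by
  have := hurn.nonempty
  -- The eigenvalue and eigenvector are chosen pointwise, with junk value 0 off the irreducible set.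
  -- Their measurability is not addressed here: it follows later, from their being almost sure
  -- limits.
  have hex : ∀ ω, ∃ (lam : ℝ) (v : Fin K → ℝ), (H ω).IsIrreducible →
      (IsDominantEigenvalue (H ω) lam ∧ IsPerronVector (H ω) lam v ∧
        ∀ w, IsPerronVector (H ω) lam w → w = v) ∧ ∃ h p, IsPerronPair (H ω) lam h p := fun ω => by
    by_cases hirr : (H ω).IsIrreducible
    · obtain ⟨lam, v, h1, h2, h3, h4⟩ := exists_dominant_perron hirr
      exact ⟨lam, v, fun _ => ⟨⟨h1, h2, h3⟩, h4⟩⟩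
    · exact ⟨0, 0, fun h => absurd h hirr⟩
  choose lam piv hlp using hex
  refine ⟨lam, piv, ?_⟩
  filter_upwards [hH.irreducible, hurn.ae_nonneg_pos,
    hurn.ae_tendsto_composition_sub hφ hmoment hH, hurn.ae_tendsto_count_sub]
    with ω hirr hpos hC hN
  obtain ⟨h1, h, p, hP⟩ := hlp ω hirr
  refine ⟨h1, ?_⟩
  refine tendsto_normalized (C := fun m => composition C₀ χ R m ω) (N := fun m => count χ m ω)
    hP.pos.ne' h1.2.1.1 h1.2.1.2.2 (fun i => ?_) hC hN
  rw [← h1.2.2 _ hP.isPerronVector]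
  exact hP.tendsto_average hirr
    (fun m i => mul_nonneg (inv_nonneg.2 (hpos m).2.le) ((hpos m).1 i))
    (fun m => by
      simp only [← Finset.mul_sum]
      exact inv_mul_cancel₀ (hpos m).2.ne')
    (fun m => (hpos m).2) (fun m => rfl) hC i

end AlmostSure

/-! ### Convergence in `L¹`. -/

section MeanConvergence

variable {Ω : Type*} [mΩ : MeasurableSpace Ω] {μ : Measure Ω}
  {E : Type*} [NormedAddCommGroup E]

theorem tendstoASAndL1_of_dominated {f : ℕ → Ω → E} {g : Ω → E} {b : Ω → ℝ}
    (hf : ∀ n, AEStronglyMeasurable (f n) μ) (hb : Integrable b μ)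
    (hfb : ∀ n, ∀ᵐ ω ∂μ, ‖f n ω‖ ≤ b ω)
    (hlim : ∀ᵐ ω ∂μ, Tendsto (fun n => f n ω) atTop (𝓝 (g ω))) : TendstoASAndL1 μ f g := by
  refine ⟨hlim, fun n => hb.mono' (hf n) (hfb n),
    hb.mono' (aestronglyMeasurable_of_tendsto_ae _ hf hlim) ?_, ?_⟩
  · filter_upwards [hlim, ae_all_iff.2 hfb] with ω h1 h2
    exact le_of_tendsto h1.norm (Eventually.of_forall h2)
  · simpa only [ofReal_norm] using
      tendsto_lintegral_norm_of_dominated_convergence hf hb.2 hfb hlim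

theorem TendstoASAndL1.add {f f' : ℕ → Ω → E} {g g' : Ω → E} (h : TendstoASAndL1 μ f g)
    (h' : TendstoASAndL1 μ f' g') :
    TendstoASAndL1 μ (fun n ω => f n ω + f' n ω) (fun ω => g ω + g' ω) := by
  refine ⟨by filter_upwards [h.1, h'.1] with ω h1 h2 using h1.add h2,
    fun n => (h.2.1 n).add (h'.2.1 n), h.2.2.1.add h'.2.2.1, ?_⟩
  have hsum := h.2.2.2.add h'.2.2.2
  rw [add_zero] at hsum
  refine tendsto_of_tendsto_of_tendsto_of_le_of_le tendsto_const_nhds hsum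
    (fun _ => zero_le) fun n => ?_
  have hm : AEMeasurable (fun ω => ‖f n ω - g ω‖ₑ) μ := ((h.2.1 n).sub h.2.2.1).1.enorm
  rw [← lintegral_add_left' hm]
  refine lintegral_mono fun ω => ?_
  rw [add_sub_add_comm]
  exact enorm_add_le _ _

theorem TendstoASAndL1.congr {f f' : ℕ → Ω → E} {g g' : Ω → E} (h : TendstoASAndL1 μ f g)
    (hf : ∀ n, f n =ᵐ[μ] f' n) (hg : g =ᵐ[μ] g') : TendstoASAndL1 μ f' g' := by
  refine ⟨?_, fun n => (h.2.1 n).congr (hf n), h.2.2.1.congr hg, h.2.2.2.congr fun n => ?_⟩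
  · filter_upwards [h.1, ae_all_iff.2 hf, hg] with ω h1 h2 h3
    rw [← h3]
    exact h1.congr h2
  · refine lintegral_congr_ae ?_
    filter_upwards [hf n, hg] with ω h2 h3
    rw [h2, h3]

theorem TendstoASAndL1.of_norm_le {f : ℕ → Ω → ℝ} {g : Ω → ℝ} {f' : ℕ → Ω → E}
    (h : TendstoASAndL1 μ f g) (hf' : ∀ n, AEStronglyMeasurable (f' n) μ)
    (hle : ∀ n, ∀ᵐ ω ∂μ, ‖f' n ω‖ ≤ ‖f n ω - g ω‖) : TendstoASAndL1 μ f' fun _ => 0 := by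
  refine ⟨?_, fun n => ((h.2.1 n).sub h.2.2.1).mono (hf' n) (hle n), integrable_zero _ _ _, ?_⟩
  · filter_upwards [h.1, ae_all_iff.2 hle] with ω h1 h2
    refine squeeze_zero_norm h2 ?_
    have := (h1.sub_const (g ω)).norm
    rwa [sub_self, norm_zero] at this
  · refine tendsto_of_tendsto_of_tendsto_of_le_of_le tendsto_const_nhds h.2.2.2
      (fun _ => zero_le) fun n => lintegral_mono_ae ?_
    filter_upwards [hle n] with ω h1
    rw [sub_zero]
    exact enorm_le_iff_norm_le.2 h1

theorem tendstoASAndL1_of_uniformIntegrable [IsFiniteMeasure μ] {f : ℕ → Ω → ℝ} {g : Ω → ℝ}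
    (hf : UniformIntegrable f 1 μ)
    (hlim : ∀ᵐ ω ∂μ, Tendsto (fun n => f n ω) atTop (𝓝 (g ω))) : TendstoASAndL1 μ f g := by
  have hg : MemLp g 1 μ := hf.memLp_of_ae_tendsto hlim
  refine ⟨hlim, fun n => memLp_one_iff_integrable.1 (hf.memLp n), memLp_one_iff_integrable.1 hg, ?_⟩
  have := tendsto_Lp_finite_of_tendsto_ae le_rfl ENNReal.one_ne_top hf.1 hg hf.2.1 hlim
  simpa only [eLpNorm_one_eq_lintegral_enorm, Pi.sub_apply] using this

variable {K : ℕ}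
  {C₀ : Ω → Fin K → ℝ} {χ : ℕ → Ω → Fin K → ℝ} {R : ℕ → Ω → Matrix (Fin K) (Fin K) ℝ}
  {φ : ℝ≥0 → ℝ≥0} {lam : Ω → ℝ} {piv : Ω → Fin K → ℝ}

theorem IsUrnModel.tendstoASAndL1_total [IsProbabilityMeasure μ] (hurn : IsUrnModel μ C₀ χ R) (hφ : IsAdmissible φ)
    (hmoment : BoundedMoment μ φ R)
    (hlim : ∀ᵐ ω ∂μ, Tendsto (fun n : ℕ => total C₀ χ R n ω / (n : ℝ)) atTop (𝓝 (lam ω))) :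
    TendstoASAndL1 μ (fun n ω => total C₀ χ R n ω / (n : ℝ)) lam := by
  obtain ⟨M, hM⟩ := hmoment.exists_bound
  set T : ℕ → Ω → ℝ := fun k ω => total C₀ χ R (k + 1) ω - total C₀ χ R k ω with hT
  have hTm : ∀ k, AEStronglyMeasurable (T k) μ := fun k =>
    ((measurable_total hurn (k + 1)).sub (measurable_total hurn k)).aestronglyMeasurable
  have hTle : ∀ k, ∀ᵐ ω ∂μ, |T k ω| ≤ ‖R (k + 1) ω‖₊ := fun k => by
    filter_upwards [hurn.ae_choice_basis] with ω hb
    obtain ⟨i₀, h⟩ := hb k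
    simp only [hT, total_eq_sum hb, Finset.sum_range_succ, sum_indicator_replacement_eq h]
    rw [← add_assoc, add_sub_cancel_left]
    exact (Finset.abs_sum_le_sum_abs _ _).trans (sum_abs_entry_le_norm _ i₀)
  -- An increment of the total is a row sum of the replacement matrix, hence at most its norm;
  -- averages of a uniformly integrable sequence are uniformly integrable.
  have hUI := uniformIntegrable_average_real le_rfl (hφ.uniformIntegrable_of_abs_le
    (fun k => measurable_matrix_nnnorm.comp (hurn.measurable_replacement (k + 1) k.succ_pos))
    hM hTm hTle)
  have hsum : ∀ (n : ℕ) ω, ((∑ i ∈ Finset.range n, T i) / (n : Ω → ℝ)) ω =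
      total C₀ χ R n ω / (n : ℝ) - total C₀ χ R 0 ω / (n : ℝ) := fun n ω => by
    rw [Pi.div_apply, Finset.sum_apply, ← sub_div]
    simp only [hT]
    rw [Finset.sum_range_sub (fun k => total C₀ χ R k ω)]
    rfl
  have hinit : ∀ᵐ ω ∂μ, Tendsto (fun n : ℕ => total C₀ χ R 0 ω / (n : ℝ)) atTop (𝓝 0) :=
    ae_of_all _ fun ω => tendsto_const_div_atTop_nhds_zero_nat _
  have h0i : Integrable (total C₀ χ R 0) μ :=
    integrable_finsetSum _ fun i _ => hurn.init_integrable i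
  have h1 := tendstoASAndL1_of_uniformIntegrable (g := lam) hUI (by
    filter_upwards [hlim, hinit] with ω h1 h2
    simp only [hsum]
    simpa using h1.sub h2)
  have h2 : TendstoASAndL1 μ (fun (n : ℕ) ω => total C₀ χ R 0 ω / (n : ℝ)) fun _ => 0 := by
    refine tendstoASAndL1_of_dominated (fun n => (h0i.div_const _).1) h0i.norm
      (fun n => ae_of_all _ fun ω => ?_) hinit
    rw [norm_div, RCLike.norm_natCast]
    rcases Nat.eq_zero_or_pos n with rfl | hn
    · simp
    · exact div_le_self (norm_nonneg _) (by exact_mod_cast hn)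
  exact (h1.add h2).congr (fun n => ae_of_all _ fun ω => by simp only [hsum]; ring)
    (ae_of_all _ fun ω => add_zero _)

theorem IsUrnModel.ae_norm_proportion_le (hurn : IsUrnModel μ C₀ χ R) (n : ℕ) :
    ∀ᵐ ω ∂μ, ‖(total C₀ χ R n ω)⁻¹ • composition C₀ χ R n ω‖ ≤ 1 := by
  filter_upwards [hurn.ae_nonneg_pos] with ω hpos
  refine (pi_norm_le_iff_of_nonneg zero_le_one).2 fun i => ?_
  rw [Pi.smul_apply, smul_eq_mul, Real.norm_of_nonneg
    (mul_nonneg (inv_nonneg.2 (hpos n).2.le) ((hpos n).1 i)), inv_mul_le_one₀ (hpos n).2]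
  exact Finset.single_le_sum (fun i _ => (hpos n).1 i) (Finset.mem_univ i)

theorem IsUrnModel.aestronglyMeasurable_proportion (hurn : IsUrnModel μ C₀ χ R) (n : ℕ) :
    AEStronglyMeasurable (fun ω => (total C₀ χ R n ω)⁻¹ • composition C₀ χ R n ω) μ :=
  ((measurable_total hurn n).inv.smul (measurable_composition hurn n)).aestronglyMeasurable

/-- Split `C_n / n = (S_n / n - λ) X_n + λ X_n` with `‖X_n‖ ≤ 1`: the first term is controlled by
the `L¹` convergence of `S_n / n`, the second by domination by `|λ|`. -/
theorem IsUrnModel.tendstoASAndL1_composition (hurn : IsUrnModel μ C₀ χ R)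
    (htotal : TendstoASAndL1 μ (fun n ω => total C₀ χ R n ω / (n : ℝ)) lam)
    (hlim : ∀ᵐ ω ∂μ, Tendsto
      (fun n => (total C₀ χ R n ω)⁻¹ • composition C₀ χ R n ω) atTop (𝓝 (piv ω))) :
    TendstoASAndL1 μ (fun n ω => (n : ℝ)⁻¹ • composition C₀ χ R n ω) fun ω => lam ω • piv ω := by
  have hm := hurn.aestronglyMeasurable_proportion
  have h1 : TendstoASAndL1 μ (fun n ω => (total C₀ χ R n ω / (n : ℝ) - lam ω) •
      (total C₀ χ R n ω)⁻¹ • composition C₀ χ R n ω) fun _ => 0 := by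
    refine htotal.of_norm_le (fun n => ((htotal.2.1 n).sub htotal.2.2.1).1.smul (hm n)) fun n => ?_
    filter_upwards [hurn.ae_norm_proportion_le n] with ω h
    rw [norm_smul]
    exact mul_le_of_le_one_right (norm_nonneg _) h
  have h2 : TendstoASAndL1 μ (fun n ω => lam ω •
      (total C₀ χ R n ω)⁻¹ • composition C₀ χ R n ω) fun ω => lam ω • piv ω := by
    refine tendstoASAndL1_of_dominated (fun n => htotal.2.2.1.1.smul (hm n)) htotal.2.2.1.norm
      (fun n => ?_) ?_
    · filter_upwards [hurn.ae_norm_proportion_le n] with ω h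
      rw [norm_smul]
      exact mul_le_of_le_one_right (norm_nonneg _) h
    · filter_upwards [hlim] with ω h using h.const_smul _
  refine (h1.add h2).congr (fun n => ?_) (ae_of_all _ fun ω => zero_add _)
  filter_upwards [hurn.ae_nonneg_pos] with ω hpos
  rw [← add_smul, sub_add_cancel, smul_smul, div_mul_eq_mul_div, mul_inv_cancel₀ (hpos n).2.ne',
    one_div]

theorem IsUrnModel.tendstoASAndL1_count [IsProbabilityMeasure μ] (hurn : IsUrnModel μ C₀ χ R)
    (hlim : ∀ᵐ ω ∂μ, Tendsto (fun n : ℕ => (n : ℝ)⁻¹ • count χ n ω) atTop (𝓝 (piv ω))) :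
    TendstoASAndL1 μ (fun n ω => (n : ℝ)⁻¹ • count χ n ω) piv := by
  refine tendstoASAndL1_of_dominated (fun n => ?_) (integrable_const (1 : ℝ)) (fun n => ?_) hlim
  · have : Measurable (count χ n) := by
      have h : count χ n = ∑ k ∈ Finset.Icc 1 n, χ k := by
        ext ω; simp [count]
      rw [h, Finset.sum_fn]
      exact Finset.measurable_fun_sum _ fun k hk => hurn.measurable_choice k (Finset.mem_Icc.1 hk).1
    exact (this.const_smul (n : ℝ)⁻¹).aestronglyMeasurable
  · filter_upwards [hurn.ae_choice_basis] with ω hb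
    refine (pi_norm_le_iff_of_nonneg zero_le_one).2 fun i => ?_
    have h0 : ∀ k, 0 ≤ (choiceEvent χ k i).indicator (fun _ => (1 : ℝ)) ω := fun k =>
      Set.indicator_nonneg (fun _ _ => zero_le_one) ω
    have h1 : ∀ k, (choiceEvent χ k i).indicator (fun _ => (1 : ℝ)) ω ≤ 1 := fun k =>
      Set.indicator_apply_le' (fun _ => le_rfl) fun _ => zero_le_one
    rw [Pi.smul_apply, smul_eq_mul, count_eq_sum hb, Real.norm_of_nonneg
      (mul_nonneg (by positivity) (Finset.sum_nonneg fun k _ => h0 k))]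
    refine inv_mul_le_one_of_le₀ ((Finset.sum_le_sum fun k _ => h1 k).trans (by simp))
      n.cast_nonneg

end MeanConvergence
end Urn

theorem mainTheorem4 {Ω : Type*} [MeasurableSpace Ω] (μ : Measure Ω) [IsProbabilityMeasure μ]
    {K : ℕ} (C₀ : Ω → Fin K → ℝ) (χ : ℕ → Ω → Fin K → ℝ)
    (R : ℕ → Ω → Matrix (Fin K) (Fin K) ℝ) (hurn : Urn.IsUrnModel μ C₀ χ R)
    (φ : ℝ≥0 → ℝ≥0) (hφ : Urn.IsAdmissible φ) (hmoment : Urn.BoundedMoment μ φ R)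
    (H : Ω → Matrix (Fin K) (Fin K) ℝ) (hH : Urn.GeneratingCesaro μ C₀ χ R H) :
    ∃ (lam : Ω → ℝ) (piv : Ω → Fin K → ℝ),
      (∀ᵐ ω ∂μ, Urn.IsDominantEigenvalue (H ω) (lam ω) ∧
        Urn.IsPerronVector (H ω) (lam ω) (piv ω) ∧
        ∀ v, Urn.IsPerronVector (H ω) (lam ω) v → v = piv ω) ∧
      Urn.TendstoASAndL1 μ
        (fun n ω => (Urn.total C₀ χ R n ω)⁻¹ • Urn.composition C₀ χ R n ω) piv ∧
      Urn.TendstoASAndL1 μ (fun n ω => Urn.total C₀ χ R n ω / (n : ℝ)) lam ∧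
      Urn.TendstoASAndL1 μ
        (fun n ω => (n : ℝ)⁻¹ • Urn.composition C₀ χ R n ω) (fun ω => lam ω • piv ω) ∧
      Urn.TendstoASAndL1 μ (fun n ω => (n : ℝ)⁻¹ • Urn.count χ n ω) piv := by
  obtain ⟨lam, piv, h⟩ := hurn.exists_ae_tendsto hφ hmoment hH
  have hX := h.mono fun ω hω => hω.2.1
  have htotal := hurn.tendstoASAndL1_total hφ hmoment (h.mono fun ω hω => hω.2.2.1)
  exact ⟨lam, piv, h.mono fun ω hω => hω.1,
    Urn.tendstoASAndL1_of_dominated hurn.aestronglyMeasurable_proportion (integrable_const 1)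
      hurn.ae_norm_proportion_le hX,
    htotal, hurn.tendstoASAndL1_composition htotal hX,
    hurn.tendstoASAndL1_count (h.mono fun ω hω => hω.2.2.2.2)⟩
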